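/- Let $d\ge 1$ and let $\Omega\subset\mathbb{R}^d$ be a bounded convex open set with $C^\infty$ boundary and outward unit normal $\nu$. Consider $-\Delta u+\omega u=f$ in $\Omega$ with one of the boundary conditions on $\partial\Omega$: $u=g$ (Dirichlet), $\partial u/\partial\nu=g$ (Neumann), or $\alpha u+\partial u/\partial\nu=g$ with a constant $\alpha>0$ (Robin). Assume $f\in L^\infty(\Omega)\cap H^1(\Omega)$, $g\in C^2(\partial\Omega)$, $\omega\in C^2(\Omega)$, $\omega\ge c_\omega>0$ in $\Omega$, and $\|\nabla\omega\|_{L^\infty(\Omega)}<c_\omega^{3/2}$. Then there is a constant $C>0$, depending only on the problem data ($\Omega,\omega,f,g$ and the boundary condition), such that the following holds. Let $u_e\in H^2(\Omega)$ be the exact solution of the problem (the equation holding weakly in $\Omega$ and the boundary condition in the sense of traces), and let $p_e=\nabla u_e$. Let $\rho(x)=1/(1+e^{-x})$ or $\rho=\tanh$, and let $\mathcal{N}$ be the set of functions $\mathbb{R}^d\to\mathbb{R}^{d+1}$ of the form $\mathbf f=A_D\mathbf f_{D-1}+b_D$, $\mathbf f_\ell=\rho(A_\ell\mathbf f_{\ell-1}+b_\ell)$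 for $1\le\ell<D$, $\mathbf f_0(x)=x$ (with $\rho$ acting componentwise and arbitrary hidden widths), having depth $D\ge1$, at most $\mathfrak n$ nonzero entries in total in the $A_\ell,b_\ell$, and all these entries bounded by $B$ in absolute value. Let $\phi:\mathbb{R}^d\times\mathbb{R}^{d+1}\to\mathbb{R}^{d+1}$ be a $C^1$ map, and let $\mathcal{P}$ be the set of pairs $(u,p)=\phi(\cdot,\mathbf f(\cdot))$, $\mathbf f\in\mathcal{N}$, where $u$ is the first component and $p$ consists of the other $d$ components. Suppose that $\phi$ enforces the boundary condition, i.e. every $(u,p)\in\mathcal{P}$ satisfies, everywhere on $\partial\Omega$, $u=g$ (Dirichlet), $p\cdot\nu=g$ (Neumann), or $\alpha u+p\cdot\nu=g$ (Robin). For $N\ge 1$ and any points $X_1,\dots,X_N\in\Omega$ (in particular for almost every realization of an i.i.d. uniform sample), set $$\ell(u,p)=\omega|p-\nabla u|^2+(-\operatorname{div}p+\omega u-f)^2,\quad \mathcal{L}(u,p)=\int_\Omega \ell(u,p)\,dx,\quad \widehat{\mathcal{L}}^N(u,p)=\frac{|\Omega|}{N}\sum_{k=1}^N \ell(u,p)(X_k).$$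 Let $(\hat u,\hat p)$ be a minimizer of $\widehat{\mathcal{L}}^N$ over $\mathcal{P}$, let $(u_{\mathcal A},p_{\mathcal A})\in\mathcal{P}$ be arbitrary, and put $$\mathcal{E}_{app}=\inf_{(u,p)\in\mathcal{P}}\big(\|u-u_e\|_{H^1(\Omega)}^2+\|p-p_e\|_{H^1(\Omega)}^2\big),\quad \mathcal{E}_{sta}=\sup_{\mathcal{P}}\big[\mathcal{L}-\widehat{\mathcal{L}}^N\big]+\sup_{\mathcal{P}}\big[\widehat{\mathcal{L}}^N-\mathcal{L}\big],$$ $$\mathcal{E}_{opt}=\widehat{\mathcal{L}}^N(u_{\mathcal A},p_{\mathcal A})-\widehat{\mathcal{L}}^N(\hat u,\hat p).$$ Then $$\|u_{\mathcal A}-u_e\|_{H^1(\Omega)}+\|p_{\mathcal A}-p_e\|_{L^2(\Omega)}\le C\,\big(\mathcal{E}_{app}+\mathcal{E}_{sta}+\mathcal{E}_{opt}\big)^{1/2}.$$ -/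

import Mathlib

open MeasureTheory Filter Topology

noncomputable section

namespace MIM

/-- Euclidean space `ℝᵈ`. -/
abbrev E (d : ℕ) := EuclideanSpace ℝ (Fin d)

variable {d : ℕ}

/-! ### Sobolev spaces on an open set -/

/-- `φ ∈ C_c^∞(Ω)`. -/
def IsTestFunction (Ω : Set (E d)) (φ : E d → ℝ) : Prop :=
  ContDiff ℝ (⊤ : ℕ∞) φ ∧ HasCompactSupport φ ∧ tsupport φ ⊆ Ω

/-- `G` is a weak (distributional) gradient of `u` on `Ω`. -/
def IsWeakGradient (Ω : Set (E d)) (u : E d → ℝ) (G : E d → E d) : Prop :=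
  LocallyIntegrableOn u Ω ∧ LocallyIntegrableOn G Ω ∧
    ∀ φ : E d → ℝ, IsTestFunction Ω φ → ∀ i : Fin d,
      ∫ x in Ω, u x * gradient φ x i = - ∫ x in Ω, G x i * φ x

open Classical in
/-- The weak gradient of `u` on the open set `Ω` (unique up to a null subset of `Ω`);
by convention `0` if there is none. -/
def weakGradient (Ω : Set (E d)) (u : E d → ℝ) : E d → E d :=
  if h : ∃ G, IsWeakGradient Ω u G then h.choose else 0

/-- `u ∈ H¹(Ω)`. -/
def MemH1 (Ω : Set (E d)) (u : E d → ℝ) : Prop :=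
  MemLp u 2 (volume.restrict Ω) ∧
    ∃ G, IsWeakGradient Ω u G ∧ MemLp G 2 (volume.restrict Ω)

/-- `u ∈ H²(Ω)`. -/
def MemH2 (Ω : Set (E d)) (u : E d → ℝ) : Prop :=
  MemH1 Ω u ∧ ∀ i : Fin d, MemH1 Ω (fun x => weakGradient Ω u x i)

/-- `‖u‖²_{H¹(Ω)}` for `u ∈ H¹(Ω)`. -/
def h1NormSq (Ω : Set (E d)) (u : E d → ℝ) : ℝ :=
  ∫ x in Ω, (u x ^ 2 + ‖weakGradient Ω u x‖ ^ 2)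

/-- `‖u‖_{H¹(Ω)}`. -/
def h1Norm (Ω : Set (E d)) (u : E d → ℝ) : ℝ := Real.sqrt (h1NormSq Ω u)

/-- `‖p‖²_{H¹(Ω)}` for a vector field `p`. -/
def h1NormSqVec (Ω : Set (E d)) (p : E d → E d) : ℝ :=
  ∑ i : Fin d, h1NormSq Ω (fun x => p x i)

/-- `‖p‖_{L²(Ω)}` for a vector field `p`. -/
def l2NormVec (Ω : Set (E d)) (p : E d → E d) : ℝ := Real.sqrt (∫ x in Ω, ‖p x‖ ^ 2)

/-- `w ∈ H¹₀(Ω)`: `w` is an `H¹(Ω)`-limit of functions in `C_c^∞(Ω)`. -/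
def MemH10 (Ω : Set (E d)) (w : E d → ℝ) : Prop :=
  MemH1 Ω w ∧ ∃ φ : ℕ → E d → ℝ, (∀ n, IsTestFunction Ω (φ n)) ∧
    Tendsto (fun n => h1Norm Ω (fun x => w x - φ n x)) atTop (𝓝 0)

/-- `w = h` on `∂Ω` in the sense of traces: `w` differs by an element of `H¹₀(Ω)` from
a `C¹` extension of the boundary datum `h`.  On a bounded open set the choice of
the extension does not matter. -/
def HasTrace (Ω : Set (E d)) (w h : E d → ℝ) : Prop :=
  ∃ W : E d → ℝ, ContDiff ℝ 1 W ∧ (∀ x ∈ frontier Ω, W x = h x) ∧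
    MemH10 Ω (fun x => w x - W x)

/-! ### Domains with smooth boundary -/

/-- `r` is a smooth defining function of `Ω`. -/
def IsDefiningFunction (Ω : Set (E d)) (r : E d → ℝ) : Prop :=
  ContDiff ℝ (⊤ : ℕ∞) r ∧ Ω = {x | r x < 0} ∧ ∀ x ∈ frontier Ω, gradient r x ≠ 0

/-- `∂Ω ∈ C^∞`. -/
def HasSmoothBoundary (Ω : Set (E d)) : Prop := ∃ r, IsDefiningFunction Ω r

open Classical in
/-- The outward unit normal `ν = ∇r / |∇r|` on `∂Ω`; it does not depend on the choice of the
defining function `r`. -/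
def outwardNormal (Ω : Set (E d)) (x : E d) : E d :=
  if h : HasSmoothBoundary Ω then ‖gradient h.choose x‖⁻¹ • gradient h.choose x else 0

/-! ### The elliptic boundary value problem -/

/-- The boundary conditions `u = g`, `∂u/∂ν = g`, and `α u + ∂u/∂ν = g` with `α > 0`. -/
inductive BoundaryCondition : Type
  | dirichlet : BoundaryCondition
  | neumann : BoundaryCondition
  | robin (α : ℝ) (hα : 0 < α) : BoundaryCondition

/-- The boundary condition for `u ∈ H²(Ω)`, in the sense of traces.  Here `N` is a `C¹` extension
of the outward unit normal, so that `∇u · N ∈ H¹(Ω)` has a trace, namely `∂u/∂ν`. -/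
def SatisfiesBC (Ω : Set (E d)) (g u : E d → ℝ) : BoundaryCondition → Prop
  | .dirichlet => HasTrace Ω u g
  | .neumann => ∃ N : E d → E d, ContDiff ℝ 1 N ∧ (∀ x ∈ frontier Ω, N x = outwardNormal Ω x) ∧
      HasTrace Ω (fun x => inner ℝ (weakGradient Ω u x) (N x)) g
  | .robin α _ => ∃ N : E d → E d, ContDiff ℝ 1 N ∧
      (∀ x ∈ frontier Ω, N x = outwardNormal Ω x) ∧
      HasTrace Ω (fun x => α * u x + inner ℝ (weakGradient Ω u x) (N x)) g

/-- `u ∈ H²(Ω)` solves `-Δu + ω u = f` weakly in `Ω` with the boundary condition `bc`. -/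
def IsExactSolution (Ω : Set (E d)) (ω f g : E d → ℝ) (bc : BoundaryCondition)
    (u : E d → ℝ) : Prop :=
  MemH2 Ω u ∧
    (∀ φ : E d → ℝ, IsTestFunction Ω φ →
      ∫ x in Ω, (inner ℝ (weakGradient Ω u x) (gradient φ x) + ω x * u x * φ x)
        = ∫ x in Ω, f x * φ x) ∧
    SatisfiesBC Ω g u bc

/-- The boundary condition for a pair `(u, p)` of `C¹` functions, where `p` stands for `∇u`. -/
def PairSatisfiesBC (Ω : Set (E d)) (g : E d → ℝ) (v : (E d → ℝ) × (E d → E d)) :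
    BoundaryCondition → Prop
  | .dirichlet => ∀ x ∈ frontier Ω, v.1 x = g x
  | .neumann => ∀ x ∈ frontier Ω, inner ℝ (v.2 x) (outwardNormal Ω x) = g x
  | .robin α _ => ∀ x ∈ frontier Ω, α * v.1 x + inner ℝ (v.2 x) (outwardNormal Ω x) = g x

/-! ### Neural networks with a modification layer -/

/-- Weight parameters `(A_ℓ, b_ℓ)`, `1 ≤ ℓ ≤ D`, of a fully connected network with input
dimension `d`, depth `D`, output dimension `m` and arbitrary hidden widths. -/
inductive Network (d : ℕ) : ℕ → ℕ → Type
  | input : Network d 0 d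
  | layer {D m : ℕ} (net : Network d D m) (m' : ℕ)
      (A : Matrix (Fin m') (Fin m) ℝ) (b : Fin m' → ℝ) : Network d (D + 1) m'

/-- `f_0(x) = x`, `f_ℓ(x) = ρ(A_ℓ f_{ℓ-1}(x) + b_ℓ)`: every layer is activated. -/
def Network.hidden (ρ : ℝ → ℝ) : {D m : ℕ} → Network d D m → E d → Fin m → ℝ
  | _, _, .input, x => fun i => x i
  | _, _, .layer net _ A b, x => fun i => ρ ((A.mulVec (net.hidden ρ x) + b) i)

/-- The function implemented by the network: the last layer is affine, without activation. -/
def Network.realize (ρ : ℝ → ℝ) : {D m : ℕ} → Network d D m → E d → Fin m → ℝ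
  | _, _, .input, x => fun i => x i
  | _, _, .layer net _ A b, x => A.mulVec (net.hidden ρ x) + b

/-- The total number of nonzero weights (entries of the `A_ℓ` and `b_ℓ`). -/
def Network.numNonzero : {D m : ℕ} → Network d D m → ℕ
  | _, _, .input => 0
  | _, _, .layer net _ A b =>
      net.numNonzero + Set.ncard {ij : Fin _ × Fin _ | A ij.1 ij.2 ≠ 0} + Set.ncard {i | b i ≠ 0}

/-- All weights are bounded by `B` in absolute value. -/
def Network.WeightsBounded (B : ℝ) : {D m : ℕ} → Network d D m → Prop
  | _, _, .input => True
  | _, _, .layer net _ A b =>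
      net.WeightsBounded B ∧ (∀ i j, |A i j| ≤ B) ∧ ∀ i, |b i| ≤ B

/-- The class `N_ρ(D, n, B)` of functions `ℝᵈ → ℝ^{d+1}` implemented by a `ρ`-network of depth `D`
with at most `n` nonzero weights, all of absolute value at most `B`. -/
def networkClass (d : ℕ) (ρ : ℝ → ℝ) (D n : ℕ) (B : ℝ) : Set (E d → Fin (d + 1) → ℝ) :=
  {F | ∃ net : Network d D (d + 1),
    net.numNonzero ≤ n ∧ net.WeightsBounded B ∧ net.realize ρ = F}

/-- The output `(u, p) = φ(x, F(x))` of the modification layer `φ`; the first component is `u`,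
the remaining `d` components are `p`. -/
def modifiedOutput (φ : E d × (Fin (d + 1) → ℝ) → (Fin (d + 1) → ℝ))
    (F : E d → Fin (d + 1) → ℝ) : (E d → ℝ) × (E d → E d) :=
  (fun x => φ (x, F x) 0, fun x => WithLp.toLp 2 (fun i : Fin d => φ (x, F x) i.succ))

/-- The parametrized class `𝒫` of pairs `(u, p)`. -/
def modifiedClass (ρ : ℝ → ℝ) (D n : ℕ) (B : ℝ)
    (φ : E d × (Fin (d + 1) → ℝ) → (Fin (d + 1) → ℝ)) : Set ((E d → ℝ) × (E d → E d)) :=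
  modifiedOutput φ '' networkClass d ρ D n B

/-! ### The loss and the three errors -/

/-- The classical divergence. -/
def divergence (p : E d → E d) (x : E d) : ℝ :=
  ∑ i : Fin d, fderiv ℝ p x (EuclideanSpace.single i 1) i

/-- `ω |p - ∇u|² + (-div p + ω u - f)²` at `x`, for a `C¹` pair `(u, p)`. -/
def lossDensity (ω f : E d → ℝ) (v : (E d → ℝ) × (E d → E d)) (x : E d) : ℝ :=
  ω x * ‖v.2 x - gradient v.1 x‖ ^ 2 + (-divergence v.2 x + ω x * v.1 x - f x) ^ 2

/-- The least-squares loss `L(u, p)`. -/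
def loss (Ω : Set (E d)) (ω f : E d → ℝ) (v : (E d → ℝ) × (E d → E d)) : ℝ :=
  ∫ x in Ω, lossDensity ω f v x

/-- The empirical loss at the sample points `X_1, …, X_N`. -/
def empiricalLoss (Ω : Set (E d)) (ω f : E d → ℝ) {N : ℕ} (X : Fin N → E d)
    (v : (E d → ℝ) × (E d → E d)) : ℝ :=
  volume.real Ω / N * ∑ k : Fin N, lossDensity ω f v (X k)

/-- The approximation error, with `p_e = ∇u_e`. -/
def approximationError (Ω : Set (E d)) (P : Set ((E d → ℝ) × (E d → E d)))
    (ue : E d → ℝ) : ℝ :=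
  ⨅ v : P, (h1NormSq Ω (fun x => v.1.1 x - ue x)
    + h1NormSqVec Ω (fun x => v.1.2 x - weakGradient Ω ue x))

/-- The statistical error. -/
def statisticalError (Ω : Set (E d)) (ω f : E d → ℝ) {N : ℕ} (X : Fin N → E d)
    (P : Set ((E d → ℝ) × (E d → E d))) : ℝ :=
  (⨆ v : P, (loss Ω ω f v.1 - empiricalLoss Ω ω f X v.1))
    + ⨆ v : P, (empiricalLoss Ω ω f X v.1 - loss Ω ω f v.1)

/-- The optimization error of `vA` with respect to the empirical minimizer `vhat`. -/
def optimizationError (Ω : Set (E d)) (ω f : E d → ℝ) {N : ℕ} (X : Fin N → E d)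
    (vA vhat : (E d → ℝ) × (E d → E d)) : ℝ :=
  empiricalLoss Ω ω f X vA - empiricalLoss Ω ω f X vhat

end MIM

end

/-! Put `w = u - u_e` and `q = p - p_e`. Since `p_e = ∇u_e` and `-div p_e + ω u_e = f` almost
everywhere, the loss equals `∫ ω|q - ∇w|² + (-div q + ω w)²`. Expanding the squares, the cross terms
combine to `-2 div(ω w q) + 2 w ∇ω·q`. The divergence integrates to the boundary integral of `ω w
q·ν`: this is zero for Dirichlet (`w = 0`) and Neumann (`q·ν = 0`), and `-α ∫ ω w²` for Robin (`q·ν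
= -α w`), so it always has the favourable sign. As `|∇ω| ≤ θ c^{3/2}` with `θ < 1`, Young's
inequality gives `2|w ∇ω·q| ≤ θ(c² w² + c|q|²)`, which the diagonal terms absorb. Hence the loss
controls `‖w‖²` in `H¹` and `‖q‖²` in `L²` (`coercive_errorDensity`). It is conversely at most a
multiple of the squared `H¹` errors (`errorDensity_le`); `loss_equiv` joins the two bounds.

The delicate point is the boundary integral, because `w` and `q` are only in `H¹`. It is handled
without a trace operator: `bdryForm` is the volume integral of `∂ᵢ(ζ w z)`. It vanishes if the
weight `ζ` has compact support in `Ω` (mollification), if the weight has a `C¹` factor vanishing on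
`∂Ω` (truncation), or if one argument lies in `H¹₀` (density). Its dependence on the normal
direction is read off from cutoffs that follow the level sets of the defining function
(`tendsto_cutoff_bdryForm`). Together these give `sum_bdryForm_nonpos`.

Finally, compare the empirical loss of the output with that of the minimizer, hence with that of any
competitor in the class (`le_of_error_splitting`). The suprema must be finite for this;
`exists_bound_modifiedClass` bounds the class uniformly, since sparsity and the weight bound control
a network whatever its width. -/

namespace MIM

variable {d : ℕ}

open scoped Convolution

/-! ### Mollification and the Leibniz rule for weak derivatives -/

/-- The correlation of two `L²` functions is continuous. -/
lemma continuous_integral_mul_translate {z g : E d → ℝ} (hz : MemLp z 2 volume)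
    (hg : MemLp g 2 volume) : Continuous fun y : E d => ∫ x, z x * g (y + x) := by
  -- The integral is the `L²` inner product of `z` with a translate of `g`, and translations act
  -- continuously on `L²`; `DomAddAct` carries that action.
  have hc : Continuous fun y : E d =>
      inner ℝ (DomAddAct.mk y +ᵥ hg.toLp g : Lp ℝ 2 (volume : Measure (E d))) (hz.toLp z) := by
    have : Fact ((2 : ENNReal) ≠ ⊤) := ⟨by simp⟩
    have h1 : Continuous fun y : E d =>
        (DomAddAct.mk y +ᵥ hg.toLp g : Lp ℝ 2 (volume : Measure (E d))) :=
      Continuous.vadd (DomAddAct.continuous_mk) continuous_const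
    exact h1.inner continuous_const
  refine hc.congr fun y => ?_
  rw [DomAddAct.mk_vadd_toLp, L2.inner_def]
  refine integral_congr_ae ?_
  filter_upwards [hz.coeFn_toLp,
    (hg.comp_measurePreserving (measurePreserving_vadd y volume)).coeFn_toLp] with x h1 h2
  change inner ℝ ((MemLp.toLp (g ∘ fun x => y +ᵥ x) _ : Lp ℝ 2 (volume : Measure (E d))) x) _ = _
  rw [h1, h2]
  simp

/-- Mollification converges weakly in `L²`. -/
lemma tendsto_integral_mul_mollify {ρ : ℕ → ContDiffBump (0 : E d)}
    (hρ : Tendsto (fun n => (ρ n).rOut) atTop (𝓝 0)) {z g : E d → ℝ} (hz : MemLp z 2 volume)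
    (hg : MemLp g 2 volume) :
    Tendsto (fun n => ∫ x, z x * ((ρ n).normed volume ⋆[ContinuousLinearMap.lsmul ℝ ℝ, volume] g) x)
      atTop (𝓝 (∫ x, z x * g x)) := by
  have hc := continuous_integral_mul_translate hz hg
  -- By Fubini, pairing `z` with the mollified `g` is mollifying the correlation of `z` and `g` and
  -- evaluating at `0`. Pointwise convergence for a continuous function then suffices.
  have key := ContDiffBump.convolution_tendsto_right_of_continuous (μ := (volume : Measure (E d)))
    hρ hc 0
  simp only [zero_add] at key
  refine key.congr fun n => ?_
  have hρi : Integrable ((ρ n).normed (volume : Measure (E d))) := (ρ n).integrable_normed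
  have hz2 : Integrable (fun x => z x ^ 2) := hz.integrable_sq
  have hg2 : Integrable (fun x => g x ^ 2) := hg.integrable_sq
  -- The bound `|z g| ≤ z² + g²` reduces joint integrability to two products of `L¹` type.
  have hI : Integrable (fun p : E d × E d => z p.1 * ((ρ n).normed volume p.2 * g (p.1 - p.2)))
      (volume.prod volume) := by
    have i1 : Integrable (fun p : E d × E d => (ρ n).normed volume p.2 * g (p.1 - p.2) ^ 2)
        (volume.prod volume) :=
      hρi.convolution_integrand (ContinuousLinearMap.mul ℝ ℝ) hg2
    have i2 : Integrable (fun p : E d × E d => z p.1 ^ 2 * (ρ n).normed volume p.2)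
        (volume.prod volume) := hz2.mul_prod hρi
    have m : AEStronglyMeasurable (fun p : E d × E d => (ρ n).normed volume p.2 * g (p.1 - p.2))
        (volume.prod volume) :=
      hρi.aestronglyMeasurable.convolution_integrand (ContinuousLinearMap.mul ℝ ℝ)
        hg.aestronglyMeasurable
    refine (i1.add i2).mono' (hz.aestronglyMeasurable.comp_fst.mul m) (Eventually.of_forall ?_)
    intro p
    have h0 : 0 ≤ (ρ n).normed volume p.2 := (ρ n).nonneg_normed p.2
    rw [Real.norm_eq_abs, abs_mul, abs_mul, abs_of_nonneg h0]
    simp only [Pi.add_apply]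
    have : |z p.1| * |g (p.1 - p.2)| ≤ g (p.1 - p.2) ^ 2 + z p.1 ^ 2 := by
      nlinarith [sq_abs (z p.1), sq_abs (g (p.1 - p.2)), sq_nonneg (|z p.1| - |g (p.1 - p.2)|),
        sq_nonneg (z p.1), sq_nonneg (g (p.1 - p.2))]
    nlinarith [mul_le_mul_of_nonneg_left this h0]
  calc ((ρ n).normed volume ⋆[ContinuousLinearMap.lsmul ℝ ℝ, volume]
        fun y => ∫ x, z x * g (y + x)) 0
      = ∫ t, ∫ x, z x * ((ρ n).normed volume t * g (x - t)) := by
        rw [convolution_def]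
        refine integral_congr_ae (Eventually.of_forall fun t => ?_)
        simp only [ContinuousLinearMap.lsmul_apply, smul_eq_mul]
        rw [← integral_const_mul]
        refine integral_congr_ae (Eventually.of_forall fun x => ?_)
        simp only [zero_sub, neg_add_eq_sub]
        ring
    _ = ∫ x, ∫ t, z x * ((ρ n).normed volume t * g (x - t)) :=
        (integral_integral_swap (f := fun x t => z x * ((ρ n).normed volume t * g (x - t))) hI).symm
    _ = _ := by
        refine integral_congr_ae (Eventually.of_forall fun x => ?_)
        simp only [convolution_def, ContinuousLinearMap.lsmul_apply, smul_eq_mul]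
        rw [integral_const_mul]

/-- The `i`-th standard basis vector. -/
noncomputable abbrev basisVec (i : Fin d) : E d := EuclideanSpace.single i 1

lemma gradient_apply (u : E d → ℝ) (x : E d) (i : Fin d) :
    gradient u x i = fderiv ℝ u x (basisVec i) := by
  have h := InnerProductSpace.toDual_symm_apply (𝕜 := ℝ) (x := basisVec i) (y := fderiv ℝ u x)
  rw [← h, real_inner_comm, EuclideanSpace.inner_single_left]
  simp [gradient]

/-- `h ∈ L²(Ω)` is the weak `i`-th partial derivative of `u ∈ L²(Ω)`. -/
structure WeakPartial (Ω : Set (E d)) (i : Fin d) (u h : E d → ℝ) : Prop where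
  memLp : MemLp u 2 (volume.restrict Ω)
  memLp_deriv : MemLp h 2 (volume.restrict Ω)
  integral_eq : ∀ φ : E d → ℝ, IsTestFunction Ω φ →
    ∫ x in Ω, u x * fderiv ℝ φ x (basisVec i) = - ∫ x in Ω, h x * φ x

/-- The derivative falls on the bump, and `t ↦ ρ(x - t)` is an admissible test function; the sign
from the reflection cancels the sign in the weak derivative. -/
lemma fderiv_mollify {ρ : ContDiffBump (0 : E d)} {g g' : E d → ℝ} {i : Fin d}
    (hg : LocallyIntegrable g volume)
    (hw : ∀ φ : E d → ℝ, ContDiff ℝ (⊤ : ℕ∞) φ → HasCompactSupport φ →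
      ∫ x, g x * fderiv ℝ φ x (basisVec i) = - ∫ x, g' x * φ x) (x : E d) :
    fderiv ℝ (ρ.normed volume ⋆[ContinuousLinearMap.lsmul ℝ ℝ, volume] g) x (basisVec i)
      = (ρ.normed volume ⋆[ContinuousLinearMap.lsmul ℝ ℝ, volume] g') x := by
  have hρs : HasCompactSupport (ρ.normed (volume : Measure (E d))) := ρ.hasCompactSupport_normed
  have hρc : ContDiff ℝ (⊤ : ℕ∞) (ρ.normed (volume : Measure (E d))) := ρ.contDiff_normed
  have h1 := hρs.hasFDerivAt_convolution_right (ContinuousLinearMap.lsmul ℝ ℝ).flip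
    hg (hρc.of_le (by exact_mod_cast le_top)) x
  have h2 : fderiv ℝ (ρ.normed volume ⋆[ContinuousLinearMap.lsmul ℝ ℝ, volume] g) x (basisVec i)
      = ∫ t, g t * fderiv ℝ (ρ.normed volume) (x - t) (basisVec i) := by
    rw [← convolution_flip, h1.fderiv, convolution_precompR_apply _ hg (hρs.fderiv ℝ)
      (hρc.continuous_fderiv (by simp)), convolution_def]
    refine integral_congr_ae (Eventually.of_forall fun t => ?_)
    simp [mul_comm]
  have h3 : ∀ t, fderiv ℝ (fun t => ρ.normed volume (x - t)) t (basisVec i)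
      = - fderiv ℝ (ρ.normed volume) (x - t) (basisVec i) := by
    intro t
    have h := ((hρc.differentiable (by simp)).differentiableAt (x := x - t)).hasFDerivAt.comp t
      ((hasFDerivAt_id t).const_sub x)
    rw [show fderiv ℝ (fun t => ρ.normed volume (x - t)) t = _ from h.fderiv]
    simp
  have h4 := hw (fun t => ρ.normed volume (x - t)) (hρc.comp (contDiff_const.sub contDiff_id))
    (hρs.comp_homeomorph (Homeomorph.subLeft x))
  simp only [h3, mul_neg, integral_neg, neg_inj] at h4
  rw [h2, h4, convolution_eq_swap]
  refine integral_congr_ae (Eventually.of_forall fun t => ?_)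
  simp [mul_comm]

/-- The weak derivative may be tested against mollified compactly supported functions. -/
lemma WeakPartial.integral_mul_eq_of_hasCompactSupport {Ω : Set (E d)} (hΩ : IsOpen Ω) {i : Fin d}
    {z z' : E d → ℝ} (hz : WeakPartial Ω i z z') {g g' : E d → ℝ} (hg : MemLp g 2 volume)
    (hg' : MemLp g' 2 volume) {K : Set (E d)} (hK : IsCompact K) (hKΩ : K ⊆ Ω)
    (hgK : Function.support g ⊆ K)
    (hw : ∀ φ : E d → ℝ, ContDiff ℝ (⊤ : ℕ∞) φ → HasCompactSupport φ →
      ∫ x, g x * fderiv ℝ φ x (basisVec i) = - ∫ x, g' x * φ x) :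
    ∫ x in Ω, z x * g' x = - ∫ x in Ω, z' x * g x := by
  obtain ⟨δ, hδ, hKδ⟩ := hK.exists_cthickening_subset_open hΩ hKΩ
  -- Outer radii at most `δ` keep the support of the mollified `g` inside the `δ`-thickening of `K`,
  -- hence inside `Ω`.
  let ρ : ℕ → ContDiffBump (0 : E d) := fun n =>
    ⟨δ / (n + 1) / 2, δ / (n + 1), by positivity, by
      have : 0 < δ / (n + 1) := by positivity
      linarith⟩
  have hρ : Tendsto (fun n => (ρ n).rOut) atTop (𝓝 0) :=
    tendsto_const_div_atTop_nhds_zero_nat δ |>.comp (tendsto_add_atTop_nat 1) |>.congr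
      fun n => by simp [ρ]
  have hρδ : ∀ n, (ρ n).rOut ≤ δ := fun n => by
    change δ / ((n : ℝ) + 1) ≤ δ
    exact div_le_self hδ.le (by linarith [(Nat.cast_nonneg n : (0 : ℝ) ≤ n)])
  have hgl : LocallyIntegrable g volume := hg.locallyIntegrable (by norm_num)
  have hind : ∀ v : E d → ℝ, MemLp v 2 (volume.restrict Ω) → MemLp (Ω.indicator v) 2 volume :=
    fun v hv => (memLp_indicator_iff_restrict hΩ.measurableSet).2 hv
  have hint : ∀ v k : E d → ℝ, ∫ x, Ω.indicator v x * k x = ∫ x in Ω, v x * k x := by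
    intro v k
    rw [← integral_indicator hΩ.measurableSet]
    refine integral_congr_ae (Eventually.of_forall fun x => ?_)
    simp only [Set.indicator_mul_left]
  have htest : ∀ n, IsTestFunction Ω
      ((ρ n).normed volume ⋆[ContinuousLinearMap.lsmul ℝ ℝ, volume] g) := by
    intro n
    have hsup : Function.support
        ((ρ n).normed volume ⋆[ContinuousLinearMap.lsmul ℝ ℝ, volume] g)
        ⊆ Metric.cthickening δ K := by
      refine (support_convolution_subset _).trans ?_
      rw [(ρ n).support_normed_eq]
      rintro _ ⟨a, ha, b, hb, rfl⟩
      refine Metric.mem_cthickening_of_dist_le _ b _ _ (hgK hb) ?_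
      have : ‖a‖ < (ρ n).rOut := by simpa using ha
      simpa [dist_eq_norm] using this.le.trans (hρδ n)
    have hts : tsupport ((ρ n).normed volume ⋆[ContinuousLinearMap.lsmul ℝ ℝ, volume] g)
        ⊆ Metric.cthickening δ K := closure_minimal hsup Metric.isClosed_cthickening
    exact ⟨(ρ n).hasCompactSupport_normed.contDiff_convolution_left _ (ρ n).contDiff_normed hgl,
      hK.cthickening.of_isClosed_subset (isClosed_tsupport _) hts, hts.trans hKδ⟩
  have l1 := tendsto_integral_mul_mollify hρ (hind z hz.memLp) hg'
  have l2 := (tendsto_integral_mul_mollify hρ (hind z' hz.memLp_deriv) hg).neg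
  simp only [hint] at l1 l2
  refine tendsto_nhds_unique l1 (l2.congr fun n => ?_)
  rw [← hz.integral_eq _ (htest n)]
  simp only [fderiv_mollify hgl hw]

lemma IsTestFunction.contDiff_one {Ω : Set (E d)} {φ : E d → ℝ} (h : IsTestFunction Ω φ) :
    ContDiff ℝ 1 φ := h.1.of_le (by exact_mod_cast le_top)

lemma integral_mul_fderiv_eq_of_hasCompactSupport {u v : E d → ℝ} (hu : ContDiff ℝ 1 u)
    (hv : ContDiff ℝ 1 v) (hs : HasCompactSupport v) (e : E d) :
    ∫ x, u x * fderiv ℝ v x e = - ∫ x, fderiv ℝ u x e * v x := by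
  have cu := hu.continuous
  have cv := hv.continuous
  have cu' : Continuous fun x => fderiv ℝ u x e := (hu.continuous_fderiv one_ne_zero).clm_apply
    continuous_const
  have cv' : Continuous fun x => fderiv ℝ v x e := (hv.continuous_fderiv one_ne_zero).clm_apply
    continuous_const
  have hs' : HasCompactSupport fun x => fderiv ℝ v x e := hs.fderiv_apply ℝ e
  refine integral_mul_fderiv_eq_neg_fderiv_mul_of_integrable ?_ ?_ ?_
    (fun x _ => hu.differentiable one_ne_zero x) (fun x _ => hv.differentiable one_ne_zero x)
  · exact (cu'.mul cv).integrable_of_hasCompactSupport hs.mul_left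
  · exact (cu.mul cv').integrable_of_hasCompactSupport hs'.mul_left
  · exact (cu.mul cv).integrable_of_hasCompactSupport hs.mul_left

/-- The weak derivative may be tested against `C¹` functions with compact support. -/
lemma WeakPartial.integral_mul_fderiv {Ω : Set (E d)} (hΩ : IsOpen Ω) {i : Fin d}
    {z z' : E d → ℝ} (hz : WeakPartial Ω i z z') {ζ : E d → ℝ} (hζ : ContDiff ℝ 1 ζ)
    (hs : HasCompactSupport ζ) (hsΩ : tsupport ζ ⊆ Ω) :
    ∫ x in Ω, z x * fderiv ℝ ζ x (basisVec i) = - ∫ x in Ω, z' x * ζ x := by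
  have cζ' : Continuous fun x => fderiv ℝ ζ x (basisVec i) :=
    (hζ.continuous_fderiv one_ne_zero).clm_apply continuous_const
  refine hz.integral_mul_eq_of_hasCompactSupport hΩ (hζ.continuous.memLp_of_hasCompactSupport hs)
    (cζ'.memLp_of_hasCompactSupport (hs.fderiv_apply ℝ _)) hs hsΩ (subset_tsupport ζ)
    fun φ hφ hφs => ?_
  exact integral_mul_fderiv_eq_of_hasCompactSupport hζ (hφ.of_le (by exact_mod_cast le_top)) hφs _

lemma integrable_fun_mul {μ : Measure (E d)} {f g : E d → ℝ} (hf : MemLp f 2 μ)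
    (hg : MemLp g 2 μ) : Integrable (fun x => f x * g x) μ := hf.integrable_mul hg

/-- Leibniz rule for weak derivatives: `∫ ∂ᵢ(ζ w z) = 0` for `ζ ∈ C¹_c(Ω)`. -/
lemma WeakPartial.integral_leibniz {Ω : Set (E d)} (hΩ : IsOpen Ω) {i : Fin d}
    {w w' z z' : E d → ℝ} (hw : WeakPartial Ω i w w') (hz : WeakPartial Ω i z z')
    {ζ : E d → ℝ} (hζ : ContDiff ℝ 1 ζ) (hs : HasCompactSupport ζ) (hsΩ : tsupport ζ ⊆ Ω) :
    ∫ x in Ω, (ζ x * (w' x * z x + w x * z' x) + fderiv ℝ ζ x (basisVec i) * (w x * z x)) = 0 := by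
  have cζ : Continuous ζ := hζ.continuous
  have cζ' : Continuous fun x => fderiv ℝ ζ x (basisVec i) :=
    (hζ.continuous_fderiv one_ne_zero).clm_apply continuous_const
  have hs' : HasCompactSupport fun x => fderiv ℝ ζ x (basisVec i) := hs.fderiv_apply ℝ _
  obtain ⟨C, hC⟩ := hs.exists_bound_of_continuous cζ
  obtain ⟨C', hC'⟩ := hs'.exists_bound_of_continuous cζ'
  have m1 : ∀ v : E d → ℝ, MemLp v 2 (volume.restrict Ω) →
      MemLp (fun x => ζ x * v x) 2 (volume.restrict Ω) := fun v hv =>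
    hv.of_le_mul (c := C) (cζ.aestronglyMeasurable.mul hv.aestronglyMeasurable)
      (Eventually.of_forall fun x => by rw [norm_mul]; gcongr; exact hC x)
  have m2 : ∀ v : E d → ℝ, MemLp v 2 (volume.restrict Ω) →
      MemLp (fun x => fderiv ℝ ζ x (basisVec i) * v x) 2 (volume.restrict Ω) := fun v hv =>
    hv.of_le_mul (c := C') (cζ'.aestronglyMeasurable.mul hv.aestronglyMeasurable)
      (Eventually.of_forall fun x => by rw [norm_mul]; gcongr; exact hC' x)
  have hζΩ : ∀ x ∉ Ω, ζ x = 0 := fun x hx => image_eq_zero_of_notMem_tsupport fun h => hx (hsΩ h)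
  have hζΩ' : ∀ x ∉ Ω, fderiv ℝ ζ x (basisVec i) = 0 := fun x hx => by
    have : x ∉ tsupport (fderiv ℝ ζ) := fun h => hx (hsΩ (tsupport_fderiv_subset ℝ h))
    rw [image_eq_zero_of_notMem_tsupport this]; rfl
  have glob : ∀ v : E d → ℝ, (∀ x ∉ Ω, v x = 0) → MemLp v 2 (volume.restrict Ω) →
      MemLp v 2 volume := fun v h0 hv => by
    rw [← memLp_indicator_iff_restrict hΩ.measurableSet] at hv
    rwa [Set.indicator_eq_self.2] at hv
    exact fun x hx => by_contra fun h => hx (h0 x h)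
  -- The derivative of `z` is tested against `ζ w`, extended by zero. That `ζ w` has weak derivative
  -- `∂ᵢζ w + ζ w'` on the whole space is seen by testing `w` with `ζ φ`, which is only `C¹`.
  have key := hz.integral_mul_eq_of_hasCompactSupport hΩ (g := fun x => ζ x * w x)
    (g' := fun x => fderiv ℝ ζ x (basisVec i) * w x + ζ x * w' x)
    (glob _ (fun x hx => by simp [hζΩ x hx]) (m1 w hw.memLp))
    (glob _ (fun x hx => by simp [hζΩ x hx, hζΩ' x hx])
      ((m2 w hw.memLp).add (m1 w' hw.memLp_deriv)))
    hs hsΩ (fun x hx => subset_tsupport ζ (left_ne_zero_of_mul hx)) ?_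
  · rw [← sub_eq_zero, sub_neg_eq_add, ← integral_add] at key
    · rw [← key]
      refine integral_congr_ae (Eventually.of_forall fun x => ?_)
      ring
    · exact hz.memLp.integrable_mul ((m2 w hw.memLp).add (m1 w' hw.memLp_deriv))
    · exact hz.memLp_deriv.integrable_mul (m1 w hw.memLp)
  · intro φ hφ hφs
    have hφ1 : ContDiff ℝ 1 φ := hφ.of_le (by exact_mod_cast le_top)
    have cφ' : Continuous fun x => fderiv ℝ φ x (basisVec i) :=
      (hφ1.continuous_fderiv one_ne_zero).clm_apply continuous_const
    have hk := hw.integral_mul_fderiv hΩ (hζ.mul hφ1) hs.mul_right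
      ((tsupport_mul_subset_left).trans hsΩ)
    have hd : ∀ x, fderiv ℝ (fun x => ζ x * φ x) x (basisVec i)
        = ζ x * fderiv ℝ φ x (basisVec i) + φ x * fderiv ℝ ζ x (basisVec i) := fun x => by
      rw [fderiv_fun_mul (hζ.differentiable one_ne_zero x) (hφ1.differentiable one_ne_zero x)]
      simp
    have hr : ∀ v : E d → ℝ, (∀ x ∉ Ω, v x = 0) → ∫ x, v x = ∫ x in Ω, v x := fun v h0 =>
      (setIntegral_eq_integral_of_forall_compl_eq_zero h0).symm
    rw [hr _ fun x hx => by simp [hζΩ x hx], hr _ fun x hx => by simp [hζΩ x hx, hζΩ' x hx]]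
    have p1 : MemLp φ 2 (volume.restrict Ω) :=
      (hφ1.continuous.memLp_of_hasCompactSupport hφs).restrict _
    have p2 : MemLp (fun x => fderiv ℝ φ x (basisVec i)) 2 (volume.restrict Ω) :=
      (cφ'.memLp_of_hasCompactSupport (hφs.fderiv_apply ℝ _)).restrict _
    simp only [hd] at hk
    have e1 : ∫ x in Ω, w x * (ζ x * fderiv ℝ φ x (basisVec i) + φ x * fderiv ℝ ζ x (basisVec i))
        = (∫ x in Ω, ζ x * w x * fderiv ℝ φ x (basisVec i))
          + ∫ x in Ω, fderiv ℝ ζ x (basisVec i) * w x * φ x := by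
      rw [← integral_add (integrable_fun_mul (m1 w hw.memLp) p2) (integrable_fun_mul (m2 w hw.memLp) p1)]
      exact integral_congr_ae (Eventually.of_forall fun x => by ring)
    have e2 : ∫ x in Ω, (fderiv ℝ ζ x (basisVec i) * w x + ζ x * w' x) * φ x
        = (∫ x in Ω, fderiv ℝ ζ x (basisVec i) * w x * φ x) + ∫ x in Ω, w' x * (ζ x * φ x) := by
      rw [← integral_add (integrable_fun_mul (m2 w hw.memLp) p1)]
      · exact integral_congr_ae (Eventually.of_forall fun x => by ring)
      · exact (((m1 w' hw.memLp_deriv).integrable_mul p1)).congr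
          (Eventually.of_forall fun x => by simp; ring)
    rw [e1] at hk
    rw [e2]
    linarith

/-! ### Bounded `C¹` multipliers -/

/-- `ζ` is `C¹` on `Ω`, bounded together with its derivative. -/
structure C1Bdd (Ω : Set (E d)) (ζ : E d → ℝ) : Prop where
  contDiffOn : ContDiffOn ℝ 1 ζ Ω
  bdd : ∃ C, ∀ x ∈ Ω, |ζ x| ≤ C ∧ ‖fderiv ℝ ζ x‖ ≤ C

namespace C1Bdd

variable {Ω : Set (E d)} {ζ η : E d → ℝ}

lemma differentiableAt (h : C1Bdd Ω ζ) (hΩ : IsOpen Ω) {x : E d} (hx : x ∈ Ω) :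
    DifferentiableAt ℝ ζ x :=
  (h.contDiffOn.contDiffAt (hΩ.mem_nhds hx)).differentiableAt one_ne_zero

lemma add (hζ : C1Bdd Ω ζ) (hη : C1Bdd Ω η) (hΩ : IsOpen Ω) : C1Bdd Ω fun x => ζ x + η x := by
  obtain ⟨C, hC⟩ := hζ.bdd
  obtain ⟨D, hD⟩ := hη.bdd
  refine ⟨hζ.contDiffOn.add hη.contDiffOn, C + D, fun x hx => ⟨?_, ?_⟩⟩
  · exact (abs_add_le _ _).trans (add_le_add (hC x hx).1 (hD x hx).1)
  · rw [fderiv_fun_add (hζ.differentiableAt hΩ hx) (hη.differentiableAt hΩ hx)]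
    exact (norm_add_le _ _).trans (add_le_add (hC x hx).2 (hD x hx).2)

lemma mul (hζ : C1Bdd Ω ζ) (hη : C1Bdd Ω η) (hΩ : IsOpen Ω) : C1Bdd Ω fun x => ζ x * η x := by
  obtain ⟨C, hC⟩ := hζ.bdd
  obtain ⟨D, hD⟩ := hη.bdd
  refine ⟨hζ.contDiffOn.mul hη.contDiffOn, C * D + D * C, fun x hx => ⟨?_, ?_⟩⟩
  · have h1 := hC x hx
    have h2 := hD x hx
    have hC0 : 0 ≤ C := (abs_nonneg _).trans h1.1
    have hD0 : 0 ≤ D := (abs_nonneg _).trans h2.1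
    rw [abs_mul]
    nlinarith [mul_le_mul h1.1 h2.1 (abs_nonneg _) hC0, mul_nonneg hD0 hC0]
  · have h1 := hC x hx
    have h2 := hD x hx
    have hC0 : 0 ≤ C := (abs_nonneg _).trans h1.1
    have hD0 : 0 ≤ D := (abs_nonneg _).trans h2.1
    rw [fderiv_fun_mul (hζ.differentiableAt hΩ hx) (hη.differentiableAt hΩ hx)]
    refine (norm_add_le _ _).trans ?_
    rw [norm_smul, norm_smul, Real.norm_eq_abs, Real.norm_eq_abs]
    exact add_le_add (mul_le_mul h1.1 h2.2 (norm_nonneg _) hC0)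
      (mul_le_mul h2.1 h1.2 (norm_nonneg _) hD0)

/-- Stated pointwise on the closure to cover quotients whose denominator may vanish away from
`closure Ω`. -/
lemma of_contDiffAt_closure (hb : Bornology.IsBounded Ω)
    (h : ∀ x ∈ closure Ω, ContDiffAt ℝ 1 ζ x) : C1Bdd Ω ζ := by
  have hK : IsCompact (closure Ω) := hb.isCompact_closure
  obtain ⟨C, hC⟩ := hK.exists_bound_of_continuousOn
    (fun x hx => (h x hx).continuousAt.continuousWithinAt : ContinuousOn ζ (closure Ω))
  obtain ⟨D, hD⟩ := hK.exists_bound_of_continuousOn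
    (fun x hx => ((h x hx).fderiv_right (m := 0) (by simp)).continuousAt.continuousWithinAt :
      ContinuousOn (fderiv ℝ ζ) (closure Ω))
  refine ⟨fun x hx => (h x (subset_closure hx)).contDiffWithinAt, max C D, fun x hx => ⟨?_, ?_⟩⟩
  · exact (hC x (subset_closure hx)).trans (le_max_left _ _)
  · exact (hD x (subset_closure hx)).trans (le_max_right _ _)

lemma of_contDiff (hb : Bornology.IsBounded Ω) (h : ContDiff ℝ 1 ζ) : C1Bdd Ω ζ :=
  of_contDiffAt_closure hb fun _ _ => h.contDiffAt

lemma memLp_mul (hζ : C1Bdd Ω ζ) (hΩ : IsOpen Ω) {v : E d → ℝ}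
    (hv : MemLp v 2 (volume.restrict Ω)) :
    MemLp (fun x => ζ x * v x) 2 (volume.restrict Ω) := by
  obtain ⟨C, hC⟩ := hζ.bdd
  refine hv.of_le_mul (c := C) ((hζ.contDiffOn.continuousOn.aestronglyMeasurable
    hΩ.measurableSet).mul hv.aestronglyMeasurable) ?_
  filter_upwards [ae_restrict_mem hΩ.measurableSet] with x hx
  rw [norm_mul]
  gcongr
  exact (hC x hx).1

lemma abs_fderiv_basisVec_le (L : E d →L[ℝ] ℝ) (i : Fin d) : |L (basisVec i)| ≤ ‖L‖ := by
  simpa using L.le_opNorm (basisVec i)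

lemma memLp_fderiv_mul (hζ : C1Bdd Ω ζ) (hΩ : IsOpen Ω) (i : Fin d) {v : E d → ℝ}
    (hv : MemLp v 2 (volume.restrict Ω)) :
    MemLp (fun x => fderiv ℝ ζ x (basisVec i) * v x) 2 (volume.restrict Ω) := by
  obtain ⟨C, hC⟩ := hζ.bdd
  have hc : ContinuousOn (fun x => fderiv ℝ ζ x (basisVec i)) Ω :=
    (hζ.contDiffOn.continuousOn_fderiv_of_isOpen hΩ le_rfl).clm_apply continuousOn_const
  refine hv.of_le_mul (c := C) ((hc.aestronglyMeasurable hΩ.measurableSet).mul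
    hv.aestronglyMeasurable) ?_
  filter_upwards [ae_restrict_mem hΩ.measurableSet] with x hx
  rw [norm_mul]
  gcongr
  exact (abs_fderiv_basisVec_le _ i).trans (hC x hx).2

end C1Bdd

/-! ### Boundary integrals written as volume integrals -/

/-- `∫_Ω ∂ᵢ(ζ w z)`, where `w'`, `z'` are the `i`-th partial derivatives of `w`, `z`; for smooth
functions this is the boundary integral of `ζ w z νᵢ`. -/
noncomputable def bdryForm (Ω : Set (E d)) (i : Fin d) (ζ w w' z z' : E d → ℝ) : ℝ :=
  ∫ x in Ω, (ζ x * (w' x * z x + w x * z' x) + fderiv ℝ ζ x (basisVec i) * (w x * z x))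

section bdryForm

variable {Ω : Set (E d)} {i : Fin d} {ζ η w w' z z' : E d → ℝ}

lemma integrable_bdryForm (hΩ : IsOpen Ω) (hζ : C1Bdd Ω ζ) (hw : WeakPartial Ω i w w')
    (hz : WeakPartial Ω i z z') :
    Integrable (fun x => ζ x * (w' x * z x + w x * z' x)
      + fderiv ℝ ζ x (basisVec i) * (w x * z x)) (volume.restrict Ω) := by
  have h1 := integrable_fun_mul (hζ.memLp_mul hΩ hw.memLp_deriv) hz.memLp
  have h2 := integrable_fun_mul (hζ.memLp_mul hΩ hw.memLp) hz.memLp_deriv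
  have h3 := integrable_fun_mul (hζ.memLp_fderiv_mul hΩ i hw.memLp) hz.memLp
  refine ((h1.add h2).add h3).congr (Eventually.of_forall fun x => ?_)
  simp only [Pi.add_apply]
  ring

lemma bdryForm_congr (hΩ : IsOpen Ω) {w₁ w₁' z₁ z₁' : E d → ℝ} {ζ₁ : E d → ℝ}
    (h : ∀ x ∈ Ω, ζ x * (w' x * z x + w x * z' x) + fderiv ℝ ζ x (basisVec i) * (w x * z x)
      = ζ₁ x * (w₁' x * z₁ x + w₁ x * z₁' x) + fderiv ℝ ζ₁ x (basisVec i) * (w₁ x * z₁ x)) :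
    bdryForm Ω i ζ w w' z z' = bdryForm Ω i ζ₁ w₁ w₁' z₁ z₁' :=
  setIntegral_congr_fun hΩ.measurableSet h

lemma bdryForm_add (hΩ : IsOpen Ω) (hζ : C1Bdd Ω ζ) (hη : C1Bdd Ω η) (hw : WeakPartial Ω i w w')
    (hz : WeakPartial Ω i z z') :
    bdryForm Ω i (fun x => ζ x + η x) w w' z z'
      = bdryForm Ω i ζ w w' z z' + bdryForm Ω i η w w' z z' := by
  rw [bdryForm, bdryForm, bdryForm, ← integral_add (integrable_bdryForm hΩ hζ hw hz)
    (integrable_bdryForm hΩ hη hw hz)]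
  refine setIntegral_congr_fun hΩ.measurableSet fun x hx => ?_
  rw [fderiv_fun_add (hζ.differentiableAt hΩ hx) (hη.differentiableAt hΩ hx)]
  simp only [add_apply]
  ring

lemma bdryForm_add_right (hΩ : IsOpen Ω) (hζ : C1Bdd Ω ζ) (hw : WeakPartial Ω i w w')
    (hz : WeakPartial Ω i z z') {y y' : E d → ℝ} (hy : WeakPartial Ω i y y') :
    bdryForm Ω i ζ w w' (fun x => z x + y x) (fun x => z' x + y' x)
      = bdryForm Ω i ζ w w' z z' + bdryForm Ω i ζ w w' y y' := by
  rw [bdryForm, bdryForm, bdryForm, ← integral_add (integrable_bdryForm hΩ hζ hw hz)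
    (integrable_bdryForm hΩ hζ hw hy)]
  refine setIntegral_congr_fun hΩ.measurableSet fun x hx => ?_
  ring

lemma bdryForm_const_mul_right (c : ℝ) :
    bdryForm Ω i ζ w w' (fun x => c * z x) (fun x => c * z' x) = c * bdryForm Ω i ζ w w' z z' := by
  rw [bdryForm, bdryForm, ← integral_const_mul]
  refine integral_congr_ae (Eventually.of_forall fun x => ?_)
  ring

lemma bdryForm_comm : bdryForm Ω i ζ w w' z z' = bdryForm Ω i ζ z z' w w' :=
  integral_congr_ae (Eventually.of_forall fun x => by ring)

/-- A `C¹` factor may be moved between the arguments of `bdryForm`. -/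
lemma bdryForm_mul (hΩ : IsOpen Ω) (hζ : C1Bdd Ω ζ) (hη : C1Bdd Ω η) :
    bdryForm Ω i (fun x => ζ x * η x) w w' z z'
      = bdryForm Ω i ζ w w' (fun x => η x * z x)
        (fun x => η x * z' x + fderiv ℝ η x (basisVec i) * z x) := by
  refine bdryForm_congr hΩ fun x hx => ?_
  rw [fderiv_fun_mul (hζ.differentiableAt hΩ hx) (hη.differentiableAt hΩ hx)]
  simp only [add_apply, smul_apply, smul_eq_mul]
  ring

/-- Extended by zero, the weight becomes a `C¹` function with compact support on the whole space, so
`WeakPartial.integral_leibniz` applies although `ζ` is controlled only inside `Ω`. -/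
lemma bdryForm_eq_zero_of_compact (hΩ : IsOpen Ω) (hζ : ContDiffOn ℝ 1 ζ Ω) {K : Set (E d)}
    (hK : IsCompact K) (hKΩ : K ⊆ Ω) (h0 : ∀ x ∈ Ω, x ∉ K → ζ x = 0) (hw : WeakPartial Ω i w w')
    (hz : WeakPartial Ω i z z') : bdryForm Ω i ζ w w' z z' = 0 := by
  have hsup : tsupport (Ω.indicator ζ) ⊆ K := by
    refine closure_minimal (fun x hx => ?_) hK.isClosed
    by_contra h
    refine hx ?_
    by_cases hxΩ : x ∈ Ω
    · rw [Set.indicator_of_mem hxΩ, h0 x hxΩ h]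
    · exact Set.indicator_of_notMem hxΩ _
  have hev : ∀ x ∈ Ω, Ω.indicator ζ =ᶠ[𝓝 x] ζ := fun x hx => by
    filter_upwards [hΩ.mem_nhds hx] with y hy using Set.indicator_of_mem hy _
  have hc : ContDiff ℝ 1 (Ω.indicator ζ) := contDiff_iff_contDiffAt.2 fun x => by
    by_cases hx : x ∈ tsupport (Ω.indicator ζ)
    · exact (hζ.contDiffAt (hΩ.mem_nhds (hKΩ (hsup hx)))).congr_of_eventuallyEq
        (hev x (hKΩ (hsup hx)))
    · exact contDiffAt_const.congr_of_eventuallyEq (notMem_tsupport_iff_eventuallyEq.1 hx)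
  have := hw.integral_leibniz hΩ hz hc (hK.of_isClosed_subset (isClosed_tsupport _) hsup)
    (hsup.trans hKΩ)
  rw [← this]
  refine bdryForm_congr hΩ fun x hx => ?_
  rw [(hev x hx).fderiv_eq, Set.indicator_of_mem hx]

end bdryForm

/-! ### Calculus of weak partial derivatives -/

section WeakPartial

variable {Ω : Set (E d)} {i : Fin d} {ζ u u' v v' : E d → ℝ}

lemma WeakPartial.of_contDiff (hb : Bornology.IsBounded Ω) (h : ContDiff ℝ 1 u) :
    WeakPartial Ω i u fun x => fderiv ℝ u x (basisVec i) := by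
  have c' : Continuous fun x => fderiv ℝ u x (basisVec i) :=
    (h.continuous_fderiv one_ne_zero).clm_apply continuous_const
  have hL : ∀ f : E d → ℝ, Continuous f → MemLp f 2 (volume.restrict Ω) := fun f hf => by
    obtain ⟨C, hC⟩ := hb.isCompact_closure.exists_bound_of_continuousOn hf.continuousOn
    have : IsFiniteMeasure (volume.restrict (closure Ω) : Measure (E d)) :=
      ⟨by simpa using hb.isCompact_closure.measure_lt_top⟩
    refine MemLp.mono_measure (Measure.restrict_mono subset_closure le_rfl)
      (MemLp.of_bound (μ := volume.restrict (closure Ω)) hf.aestronglyMeasurable C ?_)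
    exact (ae_restrict_mem isClosed_closure.measurableSet).mono fun x hx => hC x hx
  refine ⟨hL _ h.continuous, hL _ c', fun φ hφ => ?_⟩
  have hz : ∀ x ∉ Ω, φ x = 0 := fun x hx => image_eq_zero_of_notMem_tsupport fun h => hx (hφ.2.2 h)
  have hz' : ∀ x ∉ Ω, fderiv ℝ φ x (basisVec i) = 0 := fun x hx => by
    have : x ∉ tsupport (fderiv ℝ φ) := fun h => hx (hφ.2.2 (tsupport_fderiv_subset ℝ h))
    rw [image_eq_zero_of_notMem_tsupport this]; rfl
  rw [setIntegral_eq_integral_of_forall_compl_eq_zero fun x hx => by simp [hz' x hx],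
    setIntegral_eq_integral_of_forall_compl_eq_zero fun x hx => by simp [hz x hx]]
  exact integral_mul_fderiv_eq_of_hasCompactSupport h hφ.contDiff_one hφ.2.1 _

lemma WeakPartial.one (hb : Bornology.IsBounded Ω) :
    WeakPartial Ω i (fun _ => 1) fun _ => 0 := by
  simpa using WeakPartial.of_contDiff (i := i) hb (contDiff_const (c := (1 : ℝ)))

lemma IsTestFunction.memLp {φ : E d → ℝ} (hφ : IsTestFunction Ω φ) :
    MemLp φ 2 (volume.restrict Ω) :=
  (hφ.1.continuous.memLp_of_hasCompactSupport hφ.2.1).restrict _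

lemma IsTestFunction.memLp_fderiv {φ : E d → ℝ} (hφ : IsTestFunction Ω φ) (e : E d) :
    MemLp (fun x => fderiv ℝ φ x e) 2 (volume.restrict Ω) :=
  (((hφ.contDiff_one.continuous_fderiv one_ne_zero).clm_apply
    continuous_const).memLp_of_hasCompactSupport (hφ.2.1.fderiv_apply ℝ _)).restrict _

lemma WeakPartial.add (hu : WeakPartial Ω i u u') (hv : WeakPartial Ω i v v') :
    WeakPartial Ω i (fun x => u x + v x) fun x => u' x + v' x := by
  refine ⟨hu.memLp.add hv.memLp, hu.memLp_deriv.add hv.memLp_deriv, fun φ hφ => ?_⟩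
  simp only [add_mul]
  rw [integral_add (integrable_fun_mul hu.memLp (hφ.memLp_fderiv _))
    (integrable_fun_mul hv.memLp (hφ.memLp_fderiv _)),
    integral_add (integrable_fun_mul hu.memLp_deriv hφ.memLp)
    (integrable_fun_mul hv.memLp_deriv hφ.memLp), hu.integral_eq φ hφ, hv.integral_eq φ hφ]
  ring

lemma WeakPartial.const_mul (c : ℝ) (hu : WeakPartial Ω i u u') :
    WeakPartial Ω i (fun x => c * u x) fun x => c * u' x := by
  refine ⟨hu.memLp.const_mul c, hu.memLp_deriv.const_mul c, fun φ hφ => ?_⟩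
  simp only [mul_assoc, integral_const_mul, hu.integral_eq φ hφ]
  ring

lemma WeakPartial.sub (hu : WeakPartial Ω i u u') (hv : WeakPartial Ω i v v') :
    WeakPartial Ω i (fun x => u x - v x) fun x => u' x - v' x := by
  have := hu.add (hv.const_mul (-1))
  simpa only [neg_one_mul, ← sub_eq_add_neg] using this

lemma WeakPartial.zero : WeakPartial Ω i (fun _ => 0) fun _ => 0 :=
  ⟨MemLp.zero, MemLp.zero, fun φ _ => by simp⟩

lemma WeakPartial.sum {ι : Type*} (s : Finset ι) {f f' : ι → E d → ℝ}
    (h : ∀ k ∈ s, WeakPartial Ω i (f k) (f' k)) :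
    WeakPartial Ω i (fun x => ∑ k ∈ s, f k x) fun x => ∑ k ∈ s, f' k x := by
  classical
  induction s using Finset.induction_on with
  | empty => simpa using WeakPartial.zero
  | insert a s ha ih =>
    simp only [Finset.sum_insert ha]
    exact (h a (Finset.mem_insert_self a s)).add
      (ih fun k hk => h k (Finset.mem_insert_of_mem hk))

/-- The tested identity is the vanishing of `bdryForm` for the compactly supported weight `ζ φ` and
the arguments `u` and `1`. -/
lemma WeakPartial.mul (hΩ : IsOpen Ω) (hb : Bornology.IsBounded Ω) (hζ : C1Bdd Ω ζ)
    (hu : WeakPartial Ω i u u') :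
    WeakPartial Ω i (fun x => ζ x * u x)
      fun x => ζ x * u' x + fderiv ℝ ζ x (basisVec i) * u x := by
  refine ⟨hζ.memLp_mul hΩ hu.memLp,
    (hζ.memLp_mul hΩ hu.memLp_deriv).add (hζ.memLp_fderiv_mul hΩ i hu.memLp), fun φ hφ => ?_⟩
  have hφ1 : ContDiffOn ℝ 1 φ Ω := hφ.contDiff_one.contDiffOn
  have key := bdryForm_eq_zero_of_compact hΩ (hζ.contDiffOn.mul hφ1) hφ.2.1 hφ.2.2
    (fun x _ hx => by simp [image_eq_zero_of_notMem_tsupport hx]) hu (WeakPartial.one (i := i) hb)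
  rw [← sub_eq_zero, sub_neg_eq_add, ← integral_add
    (integrable_fun_mul (hζ.memLp_mul hΩ hu.memLp) (hφ.memLp_fderiv _))
    (integrable_fun_mul (f := fun x => ζ x * u' x + fderiv ℝ ζ x (basisVec i) * u x)
      ((hζ.memLp_mul hΩ hu.memLp_deriv).add (hζ.memLp_fderiv_mul hΩ i hu.memLp)) hφ.memLp), ← key]
  refine setIntegral_congr_fun hΩ.measurableSet fun x hx => ?_
  rw [fderiv_fun_mul (hζ.differentiableAt hΩ hx)
    (hφ.contDiff_one.differentiable one_ne_zero x)]
  simp only [add_apply, smul_apply, smul_eq_mul]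
  ring

lemma ae_eq_zero_of_forall_test (hΩ : IsOpen Ω) {f : E d → ℝ}
    (hf : MemLp f 2 (volume.restrict Ω))
    (h : ∀ φ, IsTestFunction Ω φ → ∫ x in Ω, f x * φ x = 0) : ∀ᵐ x ∂volume.restrict Ω, f x = 0 := by
  rw [ae_restrict_iff' hΩ.measurableSet]
  refine hΩ.ae_eq_zero_of_integral_contDiff_smul_eq_zero ?_ fun φ h1 h2 h3 => ?_
  · exact locallyIntegrableOn_of_locallyIntegrable_restrict (hf.locallyIntegrable (by norm_num))
  · rw [← h φ ⟨h1, h2, h3⟩, setIntegral_eq_integral_of_forall_compl_eq_zero]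
    · simp [mul_comm]
    · intro x hx
      rw [image_eq_zero_of_notMem_tsupport fun h => hx (h3 h), mul_zero]

/-- Weak derivatives are unique up to null sets. -/
lemma WeakPartial.ae_unique (hΩ : IsOpen Ω) (hu : WeakPartial Ω i u u')
    (hv : WeakPartial Ω i u v') : ∀ᵐ x ∂volume.restrict Ω, u' x = v' x := by
  have := ae_eq_zero_of_forall_test hΩ (hu.memLp_deriv.sub hv.memLp_deriv) fun φ hφ => ?_
  · filter_upwards [this] with x hx using sub_eq_zero.1 hx
  · have h := hu.integral_eq φ hφ
    rw [hv.integral_eq φ hφ] at h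
    simp only [Pi.sub_apply, sub_mul]
    rw [integral_sub (integrable_fun_mul hu.memLp_deriv hφ.memLp)
      (integrable_fun_mul hv.memLp_deriv hφ.memLp)]
    linarith

end WeakPartial

/-! ### Truncation, and weights vanishing on the boundary -/

section truncation

/-- A smooth function vanishing near the origin and equal to the identity far from it. -/
noncomputable def softTrunc (t : ℝ) : ℝ := t * Real.smoothTransition (t ^ 2 - 1)

lemma contDiff_softTrunc : ContDiff ℝ 1 softTrunc :=
  contDiff_id.mul (Real.smoothTransition.contDiff.comp ((contDiff_id.pow 2).sub contDiff_const))

lemma softTrunc_of_abs_le {t : ℝ} (h : |t| ≤ 1) : softTrunc t = 0 := by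
  have : t ^ 2 ≤ 1 := by rw [← sq_abs]; exact pow_le_one₀ (abs_nonneg t) h
  rw [softTrunc, Real.smoothTransition.zero_of_nonpos (by linarith), mul_zero]

lemma softTrunc_of_le_abs {t : ℝ} (h : 2 ≤ |t|) : softTrunc t = t := by
  have : 2 ^ 2 ≤ t ^ 2 := by rw [← sq_abs t]; gcongr
  rw [softTrunc, Real.smoothTransition.one_of_one_le (by linarith), mul_one]

lemma abs_softTrunc_le (t : ℝ) : |softTrunc t| ≤ |t| := by
  rw [softTrunc, abs_mul, abs_of_nonneg (Real.smoothTransition.nonneg _)]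
  exact mul_le_of_le_one_right (abs_nonneg t) (Real.smoothTransition.le_one _)

lemma deriv_softTrunc_zero : deriv softTrunc 0 = 0 := by
  have : softTrunc =ᶠ[𝓝 0] fun _ => 0 := by
    filter_upwards [Metric.ball_mem_nhds (0 : ℝ) one_pos] with t ht
    exact softTrunc_of_abs_le (by simpa using (mem_ball_zero_iff.1 ht).le)
  rw [this.deriv_eq]; simp

lemma deriv_softTrunc_of_lt {t : ℝ} (h : 2 < |t|) : deriv softTrunc t = 1 := by
  have : softTrunc =ᶠ[𝓝 t] fun t => t := by
    filter_upwards [(isOpen_lt continuous_const continuous_abs).mem_nhds h] with s hs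
    exact softTrunc_of_le_abs (le_of_lt hs)
  rw [this.deriv_eq]; simp

lemma exists_abs_deriv_softTrunc_le : ∃ C, ∀ t, |deriv softTrunc t| ≤ C := by
  obtain ⟨C, hC⟩ := (isCompact_Icc (a := (-2 : ℝ)) (b := 2)).exists_bound_of_continuousOn
    (contDiff_softTrunc.continuous_deriv le_rfl).continuousOn
  refine ⟨max C 1, fun t => ?_⟩
  rcases le_or_gt |t| 2 with h | h
  · exact (hC t (abs_le.1 h)).trans (le_max_left _ _)
  · rw [deriv_softTrunc_of_lt h]; simp

end truncation

section boundary

variable {Ω : Set (E d)} {i : Fin d} {η τ w w' z z' : E d → ℝ}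

-- Replace `τ` by `softTrunc (s τ) / s` with `s → ∞`. Each truncation vanishes near `∂Ω`, so its
-- `bdryForm` is zero, and dominated convergence passes to the limit. The derivative of the
-- truncation is `0` wherever `τ = 0`, so the limit carries the indicator of `τ ≠ 0`.
open Classical in
lemma bdryForm_trunc_limit (hΩ : IsOpen Ω) (hb : Bornology.IsBounded Ω) (hη : C1Bdd Ω η)
    (hτ : C1Bdd Ω τ) (hc : ContinuousOn τ (closure Ω)) (h0 : ∀ x ∈ frontier Ω, τ x = 0)
    (hw : WeakPartial Ω i w w') (hz : WeakPartial Ω i z z') :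
    ∫ x in Ω, (η x * τ x * (w' x * z x + w x * z' x) +
      (τ x * fderiv ℝ η x (basisVec i)
        + η x * ((if τ x = 0 then 0 else 1) * fderiv ℝ τ x (basisVec i))) * (w x * z x)) = 0 := by
  let s : ℕ → ℝ := fun n => (n : ℝ) + 1
  have hs : ∀ n, 0 < s n := fun n => by positivity
  have hs' : Tendsto s atTop atTop :=
    tendsto_atTop_add_const_right _ _ tendsto_natCast_atTop_atTop
  let σ : ℕ → E d → ℝ := fun n x => (s n)⁻¹ * softTrunc (s n * τ x)
  obtain ⟨C, hC⟩ := exists_abs_deriv_softTrunc_le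
  have hσd : ∀ n, ∀ x ∈ Ω, HasFDerivAt (σ n)
      (deriv softTrunc (s n * τ x) • fderiv ℝ τ x) x := fun n x hx => by
    have h1 := (hτ.differentiableAt hΩ hx).hasFDerivAt.const_mul (s n)
    have h2 := ((contDiff_softTrunc.differentiable one_ne_zero (s n * τ x)).hasDerivAt)
    have h3 := (h2.comp_hasFDerivAt x h1).const_mul (s n)⁻¹
    refine h3.congr_fderiv ?_
    rw [smul_smul, smul_smul]
    congr 1
    field_simp [(hs n).ne']
  have hσ0 : ∀ n, bdryForm Ω i (fun x => η x * σ n x) w w' z z' = 0 := fun n => by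
    -- This closed subset of `closure Ω` lies in `Ω` because `τ` vanishes on the frontier.
    refine bdryForm_eq_zero_of_compact hΩ (K := closure Ω ∩ {x | (s n)⁻¹ ≤ |τ x|}) ?_ ?_ ?_ ?_
      hw hz
    · exact hη.contDiffOn.mul (contDiffOn_const.mul (contDiff_softTrunc.comp_contDiffOn
        (contDiffOn_const.mul hτ.contDiffOn)))
    · refine hb.isCompact_closure.of_isClosed_subset ?_ Set.inter_subset_left
      exact hc.abs.preimage_isClosed_of_isClosed isClosed_closure isClosed_Ici
    · rintro x ⟨hx1, hx2⟩
      by_contra hx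
      have : x ∈ frontier Ω := ⟨hx1, by rwa [hΩ.interior_eq]⟩
      simp only [Set.mem_ofPred_eq, h0 x this, abs_zero] at hx2
      exact absurd (inv_pos.2 (hs n)) (not_lt.2 hx2)
    · intro x hx hxK
      have h1 : |τ x| < (s n)⁻¹ := by
        by_contra h
        exact hxK ⟨subset_closure hx, not_lt.1 h⟩
      have h2 : |s n * τ x| ≤ 1 := by
        rw [abs_mul, abs_of_pos (hs n)]
        calc s n * |τ x| ≤ s n * (s n)⁻¹ := by gcongr
          _ = 1 := mul_inv_cancel₀ (hs n).ne'
      simp [σ, softTrunc_of_abs_le h2]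
  have hlim : Tendsto (fun n => bdryForm Ω i (fun x => η x * σ n x) w w' z z') atTop
      (𝓝 (∫ x in Ω, (η x * τ x * (w' x * z x + w x * z' x) +
      (τ x * fderiv ℝ η x (basisVec i)
        + η x * ((if τ x = 0 then 0 else 1) * fderiv ℝ τ x (basisVec i))) * (w x * z x)))) := by
    obtain ⟨A, hA⟩ := hη.bdd
    obtain ⟨B, hB⟩ := hτ.bdd
    have e : ∀ n, ∀ x ∈ Ω, fderiv ℝ (fun x => η x * σ n x) x (basisVec i)
        = σ n x * fderiv ℝ η x (basisVec i)
          + η x * (deriv softTrunc (s n * τ x) * fderiv ℝ τ x (basisVec i)) := fun n x hx => by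
      rw [fderiv_fun_mul (hη.differentiableAt hΩ hx) (hσd n x hx).differentiableAt,
        (hσd n x hx).fderiv]
      simp only [add_apply, smul_apply, smul_eq_mul]
      ring
    have b1 : ∀ n x, |σ n x| ≤ |τ x| := fun n x => by
      simp only [σ]
      rw [abs_mul, abs_of_pos (inv_pos.2 (hs n)), inv_mul_le_iff₀ (hs n)]
      refine (abs_softTrunc_le _).trans ?_
      rw [abs_mul, abs_of_pos (hs n)]
    refine tendsto_integral_of_dominated_convergence
      (fun x => A * B * |w' x * z x + w x * z' x| + (B * A + A * (C * B)) * |w x * z x|) ?_ ?_ ?_ ?_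
    · intro n
      have hσ : C1Bdd Ω (σ n) := by
        refine ⟨contDiffOn_const.mul (contDiff_softTrunc.comp_contDiffOn
          (contDiffOn_const.mul hτ.contDiffOn)), max B (C * B), fun x hx => ⟨?_, ?_⟩⟩
        · exact ((b1 n x).trans (hB x hx).1).trans (le_max_left _ _)
        · rw [(hσd n x hx).fderiv, norm_smul]
          refine (mul_le_mul (hC _) (hB x hx).2 (norm_nonneg _) ?_).trans (le_max_right _ _)
          exact (abs_nonneg _).trans (hC 0)
      exact (integrable_bdryForm hΩ (hη.mul hσ hΩ) hw hz).aestronglyMeasurable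
    · refine Integrable.add (Integrable.const_mul (Integrable.abs ?_) _)
        (Integrable.const_mul (Integrable.abs ?_) _)
      · exact (integrable_fun_mul hw.memLp_deriv hz.memLp).add
          (integrable_fun_mul hw.memLp hz.memLp_deriv)
      · exact integrable_fun_mul hw.memLp hz.memLp
    · intro n
      filter_upwards [ae_restrict_mem hΩ.measurableSet] with x hx
      rw [e n x hx, Real.norm_eq_abs]
      have hA0 : 0 ≤ A := (abs_nonneg _).trans (hA x hx).1
      have hB0 : 0 ≤ B := (abs_nonneg _).trans (hB x hx).1
      have hC0 : 0 ≤ C := (abs_nonneg _).trans (hC 0)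
      have t1 : |η x * σ n x| ≤ A * B := by
        rw [abs_mul]
        exact mul_le_mul (hA x hx).1 ((b1 n x).trans (hB x hx).1) (abs_nonneg _) hA0
      have t2 : |σ n x * fderiv ℝ η x (basisVec i)
          + η x * (deriv softTrunc (s n * τ x) * fderiv ℝ τ x (basisVec i))|
          ≤ B * A + A * (C * B) := by
        refine (abs_add_le _ _).trans ?_
        simp only [abs_mul]
        have := (C1Bdd.abs_fderiv_basisVec_le (fderiv ℝ η x) i).trans (hA x hx).2
        have := (C1Bdd.abs_fderiv_basisVec_le (fderiv ℝ τ x) i).trans (hB x hx).2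
        have := (b1 n x).trans (hB x hx).1
        have := (hA x hx).1
        have := hC (s n * τ x)
        gcongr
      refine (abs_add_le _ _).trans ?_
      rw [abs_mul, abs_mul (_ + _) (w x * z x)]
      gcongr
    · filter_upwards [ae_restrict_mem hΩ.measurableSet] with x hx
      refine Tendsto.congr' ?_ tendsto_const_nhds
      by_cases h : τ x = 0
      · refine Eventually.of_forall fun n => ?_
        simp only
        rw [e n x hx]
        simp [σ, h, deriv_softTrunc_zero, softTrunc_of_abs_le]
      · have : ∀ᶠ n in atTop, 2 < |s n * τ x| := by
          filter_upwards [hs'.eventually_gt_atTop (2 / |τ x|)] with n hn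
          rw [abs_mul, abs_of_pos (hs n)]
          rwa [div_lt_iff₀ (abs_pos.2 h)] at hn
        filter_upwards [this] with n hn
        have hσx : σ n x = τ x := by
          simp only [σ]
          rw [softTrunc_of_le_abs hn.le, ← mul_assoc, inv_mul_cancel₀ (hs n).ne', one_mul]
        rw [e n x hx, hσx, deriv_softTrunc_of_lt hn, if_neg h]
  simp only [hσ0] at hlim
  exact (tendsto_nhds_unique hlim tendsto_const_nhds)

lemma IsTestFunction.c1Bdd (hb : Bornology.IsBounded Ω) {φ : E d → ℝ} (hφ : IsTestFunction Ω φ) :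
    C1Bdd Ω φ := C1Bdd.of_contDiff hb hφ.contDiff_one

open Classical in
/-- The derivative of a `C¹` function vanishes almost everywhere on its zero set. -/
lemma ae_fderiv_eq_zero_of_eq_zero (hΩ : IsOpen Ω) (hb : Bornology.IsBounded Ω)
    (hτ : C1Bdd Ω τ) (hc : ContinuousOn τ (closure Ω)) (h0 : ∀ x ∈ frontier Ω, τ x = 0) :
    ∀ᵐ x ∂volume.restrict Ω, τ x = 0 → fderiv ℝ τ x (basisVec i) = 0 := by
  have hone : WeakPartial Ω i (fun _ => 1) fun _ => 0 := WeakPartial.one hb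
  have h1 := (hone.mul hΩ hb hτ)
  have hd : MemLp (fun x => fderiv ℝ τ x (basisVec i)) 2 (volume.restrict Ω) := by
    simpa using h1.memLp_deriv
  have hm : MemLp (fun x => (if τ x = 0 then 0 else 1) * fderiv ℝ τ x (basisVec i)) 2
      (volume.restrict Ω) := by
    have hcΩ : AEMeasurable τ (volume.restrict Ω) :=
      ((hτ.contDiffOn.continuousOn).aemeasurable hΩ.measurableSet)
    have hg : Measurable fun t : ℝ => if t = 0 then (0 : ℝ) else 1 :=
      Measurable.ite (measurableSet_singleton 0) measurable_const measurable_const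
    refine hd.mono ((hg.comp_aemeasurable hcΩ).aestronglyMeasurable.mul hd.aestronglyMeasurable)
      (Eventually.of_forall fun x => ?_)
    split_ifs <;> simp
  have key : WeakPartial Ω i τ fun x => (if τ x = 0 then 0 else 1) * fderiv ℝ τ x (basisVec i) := by
    refine ⟨by simpa using h1.memLp, hm, fun φ hφ => ?_⟩
    -- With a test function as weight and both arguments equal to `1`, the limit says that `1_{τ ≠
    -- 0} ∂ᵢτ` is also a weak derivative of `τ`. Uniqueness then forces `∂ᵢτ = 0` almost everywhere
    -- on the zero set.
    have hl := bdryForm_trunc_limit hΩ hb (hφ.c1Bdd hb) hτ hc h0 hone hone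
    rw [← sub_eq_zero, sub_neg_eq_add, ← integral_add
      (integrable_fun_mul (by simpa using h1.memLp) (hφ.memLp_fderiv _))
      (integrable_fun_mul hm hφ.memLp)]
    refine Eq.trans ?_ hl
    refine integral_congr_ae (Eventually.of_forall fun x => ?_)
    ring
  have key' : WeakPartial Ω i τ fun x => fderiv ℝ τ x (basisVec i) := by simpa using h1
  filter_upwards [key.ae_unique hΩ key'] with x hx h
  rw [← hx, if_pos h, zero_mul]

/-- `bdryForm` vanishes if the weight contains a `C¹` factor vanishing on the boundary. -/
lemma bdryForm_eq_zero_of_frontier (hΩ : IsOpen Ω) (hb : Bornology.IsBounded Ω) (hη : C1Bdd Ω η)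
    (hτ : C1Bdd Ω τ) (hc : ContinuousOn τ (closure Ω)) (h0 : ∀ x ∈ frontier Ω, τ x = 0)
    (hw : WeakPartial Ω i w w') (hz : WeakPartial Ω i z z') :
    bdryForm Ω i (fun x => η x * τ x) w w' z z' = 0 := by
  classical
  refine Eq.trans ?_ (bdryForm_trunc_limit hΩ hb hη hτ hc h0 hw hz)
  refine integral_congr_ae ?_
  filter_upwards [ae_restrict_mem hΩ.measurableSet,
    ae_fderiv_eq_zero_of_eq_zero (i := i) hΩ hb hτ hc h0] with x hx h
  rw [fderiv_fun_mul (hη.differentiableAt hΩ hx) (hτ.differentiableAt hΩ hx)]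
  simp only [add_apply, smul_apply, smul_eq_mul]
  by_cases hx0 : τ x = 0
  · simp [h hx0]
  · simp only [if_neg hx0]
    ring

end boundary

/-! ### Weak gradients, Sobolev norms and `H¹₀` -/

section weakGradient

variable {Ω : Set (E d)}

lemma integrableOn_mul_test (hΩ : IsOpen Ω) {g φ : E d → ℝ} (hg : LocallyIntegrableOn g Ω)
    (hφ : IsTestFunction Ω φ) : IntegrableOn (fun x => g x * φ x) Ω := by
  have hK : IsCompact (tsupport φ) := hφ.2.1
  have h1 : IntegrableOn (fun x => g x * φ x) (tsupport φ) :=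
    (hg.integrableOn_compact_subset hφ.2.2 hK).mul_continuousOn hφ.1.continuous.continuousOn hK
  refine IntegrableOn.of_forall_sdiff_eq_zero h1 hΩ.measurableSet fun x hx => ?_
  rw [image_eq_zero_of_notMem_tsupport hx.2, mul_zero]

lemma LocallyIntegrableOn.coord {G : E d → E d} (hG : LocallyIntegrableOn G Ω) (i : Fin d) :
    LocallyIntegrableOn (fun x => G x i) Ω := fun x hx => by
  obtain ⟨t, ht, h⟩ := hG x hx
  exact ⟨t, ht, (EuclideanSpace.proj (𝕜 := ℝ) i : E d →L[ℝ] ℝ).integrable_comp h⟩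

lemma IsWeakGradient.ae_unique (hΩ : IsOpen Ω) {u : E d → ℝ} {G H : E d → E d}
    (hG : IsWeakGradient Ω u G) (hH : IsWeakGradient Ω u H) :
    ∀ᵐ x ∂volume.restrict Ω, G x = H x := by
  have key : ∀ i, ∀ᵐ x ∂volume.restrict Ω, G x i - H x i = 0 := fun i => by
    rw [ae_restrict_iff' hΩ.measurableSet]
    have g1 := LocallyIntegrableOn.coord hG.2.1 i
    have g2 := LocallyIntegrableOn.coord hH.2.1 i
    refine hΩ.ae_eq_zero_of_integral_contDiff_smul_eq_zero (g1.sub g2) fun φ h1 h2 h3 => ?_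
    have hφ : IsTestFunction Ω φ := ⟨h1, h2, h3⟩
    have e := (hG.2.2 φ hφ i).symm.trans (hH.2.2 φ hφ i)
    rw [← setIntegral_eq_integral_of_forall_compl_eq_zero (s := Ω) fun x hx => by
      rw [image_eq_zero_of_notMem_tsupport fun h => hx (h3 h), zero_smul]]
    have : ∫ x in Ω, (G x i * φ x - H x i * φ x) = 0 := by
      rw [integral_sub (integrableOn_mul_test hΩ g1 hφ) (integrableOn_mul_test hΩ g2 hφ)]
      linarith
    rw [← this]
    refine integral_congr_ae (Eventually.of_forall fun x => ?_)
    simp only [smul_eq_mul]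
    ring
  filter_upwards [ae_all_iff.2 key] with x hx
  ext i
  exact sub_eq_zero.1 (hx i)

lemma isWeakGradient_weakGradient {u : E d → ℝ} (h : ∃ G, IsWeakGradient Ω u G) :
    IsWeakGradient Ω u (weakGradient Ω u) := by
  rw [weakGradient, dif_pos h]
  exact h.choose_spec

/-- The chosen `weakGradient` need not be the square-integrable witness; uniqueness among locally
integrable gradients transfers the `L²` bound to it. -/
lemma MemH1.weakPartial (hΩ : IsOpen Ω) {u : E d → ℝ} (h : MemH1 Ω u) (i : Fin d) :
    WeakPartial Ω i u fun x => weakGradient Ω u x i := by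
  obtain ⟨hu, G, hG, hG2⟩ := h
  have hw := isWeakGradient_weakGradient ⟨G, hG⟩
  have hae := hw.ae_unique hΩ hG
  refine ⟨hu, ?_, fun φ hφ => ?_⟩
  · have h1 : MemLp (fun x => G x i) 2 (volume.restrict Ω) := hG2.eval_piLp i
    exact h1.ae_eq (hae.mono fun x hx => by simp only [hx])
  · rw [← hw.2.2 φ hφ i]
    simp only [gradient_apply]

/-- The hypothesis `hL` is separate because for `d = 0` the family `hu` is empty and gives no
integrability of `u`. -/
lemma isWeakGradient_of_weakPartial {u : E d → ℝ} {h : Fin d → E d → ℝ}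
    (hu : ∀ i, WeakPartial Ω i u (h i)) (hL : MemLp u 2 (volume.restrict Ω)) :
    IsWeakGradient Ω u fun x => WithLp.toLp 2 fun i => h i x := by
  have hm : MemLp (fun x => (WithLp.toLp 2 fun i => h i x : E d)) 2 (volume.restrict Ω) :=
    MemLp.of_eval_piLp fun i => (hu i).memLp_deriv
  refine ⟨locallyIntegrableOn_of_locallyIntegrable_restrict (hL.locallyIntegrable (by norm_num)),
    locallyIntegrableOn_of_locallyIntegrable_restrict (hm.locallyIntegrable (by norm_num)),
    fun φ hφ i => ?_⟩
  simp only [gradient_apply]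
  exact (hu i).integral_eq φ hφ

lemma weakGradient_ae_eq (hΩ : IsOpen Ω) {u : E d → ℝ} {h : Fin d → E d → ℝ}
    (hu : ∀ i, WeakPartial Ω i u (h i)) (hL : MemLp u 2 (volume.restrict Ω)) :
    ∀ᵐ x ∂volume.restrict Ω, weakGradient Ω u x = WithLp.toLp 2 fun i => h i x :=
  (isWeakGradient_weakGradient ⟨_, isWeakGradient_of_weakPartial hu hL⟩).ae_unique hΩ
    (isWeakGradient_of_weakPartial hu hL)

lemma h1NormSq_eq (hΩ : IsOpen Ω) {u : E d → ℝ} {h : Fin d → E d → ℝ}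
    (hu : ∀ i, WeakPartial Ω i u (h i)) (hL : MemLp u 2 (volume.restrict Ω)) :
    h1NormSq Ω u = ∫ x in Ω, (u x ^ 2 + ∑ i, h i x ^ 2) := by
  refine integral_congr_ae ?_
  filter_upwards [weakGradient_ae_eq hΩ hu hL] with x hx
  rw [hx, EuclideanSpace.norm_sq_eq]
  simp

lemma tendsto_integral_mul_zero {v : ℕ → E d → ℝ} {a : E d → ℝ} {S : ℕ → ℝ}
    (hv : ∀ n, MemLp (v n) 2 (volume.restrict Ω)) (ha : MemLp a 2 (volume.restrict Ω))
    (hle : ∀ n, ∫ x in Ω, v n x ^ 2 ≤ S n) (hS : Tendsto S atTop (𝓝 0)) :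
    Tendsto (fun n => ∫ x in Ω, v n x * a x) atTop (𝓝 0) := by
  have hb : ∀ n, ‖∫ x in Ω, v n x * a x‖ ≤ √(S n) * √(∫ x in Ω, a x ^ 2) := fun n => by
    refine (norm_integral_le_integral_norm _).trans ?_
    have := integral_mul_norm_le_Lp_mul_Lq (μ := volume.restrict Ω) (f := v n) (g := a)
      Real.HolderConjugate.two_two (by simpa using hv n) (by simpa using ha)
    simp only [norm_mul]
    refine this.trans ?_
    rw [← Real.sqrt_eq_rpow, ← Real.sqrt_eq_rpow]
    simp only [Real.rpow_two, Real.norm_eq_abs, sq_abs]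
    gcongr
    exact hle n
  refine squeeze_zero_norm hb ?_
  simpa using (hS.sqrt).mul_const (√(∫ x in Ω, a x ^ 2))

/-- By Cauchy–Schwarz, `bdryForm` is continuous in its last argument for the `H¹` norm. It vanishes
on test functions, since these can be moved into the weight and make its support compact. -/
lemma bdryForm_eq_zero_of_memH10 (hΩ : IsOpen Ω) (hb : Bornology.IsBounded Ω) {i : Fin d}
    {k ζ z z' : E d → ℝ} {k' : Fin d → E d → ℝ} (hk : MemH10 Ω k)
    (hk' : ∀ i, WeakPartial Ω i k (k' i)) (hζ : C1Bdd Ω ζ) (hz : WeakPartial Ω i z z') :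
    bdryForm Ω i ζ z z' k (k' i) = 0 := by
  obtain ⟨hk1, φ, hφ, hlim⟩ := hk
  have hφw : ∀ n j, WeakPartial Ω j (φ n) fun x => fderiv ℝ (φ n) x (basisVec j) := fun n j =>
    WeakPartial.of_contDiff hb (hφ n).contDiff_one
  have hsub : ∀ n j, WeakPartial Ω j (fun x => k x - φ n x)
      fun x => k' j x - fderiv ℝ (φ n) x (basisVec j) := fun n j => (hk' j).sub (hφw n j)
  have hS : ∀ n, h1NormSq Ω (fun x => k x - φ n x) = ∫ x in Ω, ((k x - φ n x) ^ 2
      + ∑ j, (k' j x - fderiv ℝ (φ n) x (basisVec j)) ^ 2) := fun n =>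
    h1NormSq_eq hΩ (hsub n) (hk1.1.sub (hφ n).memLp)
  have hS0 : Tendsto (fun n => h1NormSq Ω (fun x => k x - φ n x)) atTop (𝓝 0) := by
    have := hlim.pow 2
    refine (by simpa using this : Tendsto _ _ (𝓝 (0 : ℝ))).congr fun n => ?_
    exact Real.sq_sqrt (integral_nonneg fun x => by positivity)
  have i0 : ∀ n, Integrable (fun x => (k x - φ n x) ^ 2) (volume.restrict Ω) := fun n =>
    (hk1.1.sub (hφ n).memLp).integrable_sq
  have i1 : ∀ n j, Integrable (fun x => (k' j x - fderiv ℝ (φ n) x (basisVec j)) ^ 2)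
      (volume.restrict Ω) := fun n j => (hsub n j).memLp_deriv.integrable_sq
  have hI : ∀ n, Integrable (fun x => (k x - φ n x) ^ 2
      + ∑ j, (k' j x - fderiv ℝ (φ n) x (basisVec j)) ^ 2) (volume.restrict Ω) := fun n =>
    (i0 n).add (integrable_finsetSum _ fun j _ => i1 n j)
  have l1 := tendsto_integral_mul_zero (Ω := Ω) (v := fun n x => k x - φ n x)
    (a := fun x => ζ x * z' x + fderiv ℝ ζ x (basisVec i) * z x)
    (fun n => hk1.1.sub (hφ n).memLp)
    ((hζ.memLp_mul hΩ hz.memLp_deriv).add (hζ.memLp_fderiv_mul hΩ i hz.memLp))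
    (fun n => (integral_mono (i0 n) (hI n) fun x =>
      le_add_of_nonneg_right (Finset.sum_nonneg fun j _ => sq_nonneg _)).trans (hS n).ge) hS0
  have l2 := tendsto_integral_mul_zero (Ω := Ω)
    (v := fun n x => k' i x - fderiv ℝ (φ n) x (basisVec i)) (a := fun x => ζ x * z x)
    (fun n => (hsub n i).memLp_deriv) (hζ.memLp_mul hΩ hz.memLp)
    (fun n => (integral_mono (i1 n i) (hI n) fun x => by
      refine (Finset.single_le_sum (f := fun j => (k' j x - fderiv ℝ (φ n) x (basisVec j)) ^ 2)
        (fun j _ => sq_nonneg _) (Finset.mem_univ i)).trans ?_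
      exact le_add_of_nonneg_left (sq_nonneg _)).trans (hS n).ge) hS0
  have l3 := l1.add l2
  rw [add_zero] at l3
  refine tendsto_nhds_unique (tendsto_const_nhds.congr fun n => ?_) l3
  have h0 : bdryForm Ω i ζ z z' (φ n) (fun x => fderiv ℝ (φ n) x (basisVec i)) = 0 := by
    have hone : WeakPartial Ω i (fun _ => 1) fun _ => 0 := WeakPartial.one hb
    have h1 := bdryForm_eq_zero_of_compact (i := i) hΩ
      (hζ.contDiffOn.mul (hφ n).contDiff_one.contDiffOn)
      (hφ n).2.1 (hφ n).2.2 (fun x _ hx => by simp [image_eq_zero_of_notMem_tsupport hx]) hz hone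
    refine Eq.trans ?_ h1
    refine (bdryForm_congr hΩ fun x hx => ?_)
    rw [fderiv_fun_mul (hζ.differentiableAt hΩ hx) ((hφ n).contDiff_one.differentiable one_ne_zero x)]
    simp only [add_apply, smul_apply, smul_eq_mul]
    ring
  have h2 := bdryForm_add_right hΩ hζ hz (hsub n i) (hφw n i)
  simp only [sub_add_cancel] at h2
  rw [h0, add_zero] at h2
  rw [← integral_add (integrable_fun_mul (hsub n i).memLp
      (g := fun x => ζ x * z' x + fderiv ℝ ζ x (basisVec i) * z x)
      ((hζ.memLp_mul hΩ hz.memLp_deriv).add (hζ.memLp_fderiv_mul hΩ i hz.memLp)))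
    (integrable_fun_mul (hsub n i).memLp_deriv (hζ.memLp_mul hΩ hz.memLp))]
  refine Eq.trans h2 ?_
  refine integral_congr_ae (Eventually.of_forall fun x => ?_)
  ring

end weakGradient

/-! ### Cutoffs along the defining function -/

section cutoff

variable {Ω : Set (E d)} {r : E d → ℝ}

/-- Cutoff functions exhausting the sublevel set `{r < 0}`. -/
noncomputable def cutoff (r : E d → ℝ) (n : ℕ) (x : E d) : ℝ :=
  Real.smoothTransition (-((n : ℝ) + 1) * r x - 1)

lemma isTestFunction_cutoff (hb : Bornology.IsBounded Ω) (hr : ContDiff ℝ (⊤ : ℕ∞) r)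
    (hΩr : Ω = {x | r x < 0}) (n : ℕ) : IsTestFunction Ω (cutoff r n) := by
  have hn : (0 : ℝ) < (n : ℝ) + 1 := by positivity
  have hsup : tsupport (cutoff r n) ⊆ {x | ((n : ℝ) + 1) * r x ≤ -1} := by
    refine closure_minimal (fun x hx => ?_)
      (isClosed_le (continuous_const.mul hr.continuous) continuous_const)
    by_contra h
    refine hx (Real.smoothTransition.zero_of_nonpos ?_)
    have : ¬ ((n : ℝ) + 1) * r x ≤ -1 := h
    linarith [not_le.1 this]
  have hsΩ : tsupport (cutoff r n) ⊆ Ω := fun x hx => by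
    have h : ((n : ℝ) + 1) * r x ≤ -1 := hsup hx
    rw [hΩr]
    change r x < 0
    by_contra h0
    nlinarith [not_lt.1 h0]
  refine ⟨Real.smoothTransition.contDiff.comp ((contDiff_const.mul hr).sub contDiff_const), ?_, hsΩ⟩
  exact hb.isCompact_closure.of_isClosed_subset (isClosed_tsupport _) (hsΩ.trans subset_closure)

lemma fderiv_cutoff (hr : ContDiff ℝ (⊤ : ℕ∞) r) (n : ℕ) (x : E d) :
    fderiv ℝ (cutoff r n) x
      = (-(((n : ℝ) + 1) * deriv Real.smoothTransition (-((n : ℝ) + 1) * r x - 1))) •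
        fderiv ℝ r x := by
  have h1 := ((hr.differentiable (by simp) x).hasFDerivAt.const_mul (-((n : ℝ) + 1))).sub_const 1
  have h2 := (Real.smoothTransition.contDiff (n := 1)).differentiable one_ne_zero
    (-((n : ℝ) + 1) * r x - 1) |>.hasDerivAt
  have h3 := (h2.comp_hasFDerivAt x h1).fderiv
  change fderiv ℝ (cutoff r n) x = _ at h3
  rw [h3, smul_smul]
  congr 1
  ring

/-- For the weight `cutoff r n * Z j` the form is zero, so the integral of the cutoff times `∂ⱼ(Zⱼ w
z)` equals minus the integral in which the derivative falls on the cutoff. The first tends to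
`bdryForm`. Summed over `j`, the second lives in a thin layer at the boundary and sees `Z` only
through `∇r·Z`, which acts as the normal component. -/
lemma tendsto_cutoff_bdryForm (hΩ : IsOpen Ω) (hb : Bornology.IsBounded Ω)
    (hr : ContDiff ℝ (⊤ : ℕ∞) r) (hΩr : Ω = {x | r x < 0}) {Z w' z' : Fin d → E d → ℝ}
    {w z : E d → ℝ} (hZ : ∀ j, C1Bdd Ω (Z j)) (hw : ∀ j, WeakPartial Ω j w (w' j))
    (hz : ∀ j, WeakPartial Ω j z (z' j)) :
    Tendsto (fun n : ℕ => ∫ x in Ω, ((n : ℝ) + 1) *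
        deriv Real.smoothTransition (-((n : ℝ) + 1) * r x - 1) *
        (∑ j, fderiv ℝ r x (basisVec j) * Z j x) * (w x * z x)) atTop
      (𝓝 (∑ j, bdryForm Ω j (Z j) w (w' j) z (z' j))) := by
  have hφ := fun n => isTestFunction_cutoff hb hr hΩr n
  have hφb := fun n => (hφ n).c1Bdd hb
  have hint : ∀ n j, Integrable (fun x => -fderiv ℝ (cutoff r n) x (basisVec j) * Z j x *
      (w x * z x)) (volume.restrict Ω) := fun n j => by
    refine (integrable_fun_mul ((hφb n).memLp_fderiv_mul hΩ j ((hZ j).memLp_mul hΩ (hw j).memLp))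
      (hz j).memLp).neg.congr (Eventually.of_forall fun x => ?_)
    simp only [Pi.neg_apply]
    ring
  have key : ∀ j, Tendsto (fun n => ∫ x in Ω, -fderiv ℝ (cutoff r n) x (basisVec j) * Z j x *
      (w x * z x)) atTop (𝓝 (bdryForm Ω j (Z j) w (w' j) z (z' j))) := fun j => by
    have hI := integrable_bdryForm hΩ (hZ j) (hw j) (hz j)
    have heq : ∀ n, ∫ x in Ω, -fderiv ℝ (cutoff r n) x (basisVec j) * Z j x * (w x * z x)
        = ∫ x in Ω, cutoff r n x * (Z j x * (w' j x * z x + w x * z' j x)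
          + fderiv ℝ (Z j) x (basisVec j) * (w x * z x)) := fun n => by
      have h0 := bdryForm_eq_zero_of_compact (i := j) hΩ
        ((hφ n).contDiff_one.contDiffOn.mul (hZ j).contDiffOn) (hφ n).2.1 (hφ n).2.2
        (fun x _ hx => by simp [image_eq_zero_of_notMem_tsupport hx]) (hw j) (hz j)
      have hJ := integrable_bdryForm hΩ ((hφb n).mul (hZ j) hΩ) (hw j) (hz j)
      have h1 := integral_add hJ (hint n j)
      rw [bdryForm] at h0
      rw [h0, zero_add] at h1
      rw [← h1]
      refine setIntegral_congr_fun hΩ.measurableSet fun x hx => ?_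
      rw [fderiv_fun_mul ((hφ n).contDiff_one.differentiable one_ne_zero x)
        ((hZ j).differentiableAt hΩ hx)]
      simp only [add_apply, smul_apply, smul_eq_mul]
      ring
    simp only [heq]
    refine tendsto_integral_of_dominated_convergence (fun x => |Z j x * (w' j x * z x + w x * z' j x)
          + fderiv ℝ (Z j) x (basisVec j) * (w x * z x)|) (fun n => ?_) hI.abs (fun n => ?_) ?_
    · exact (hφ n).1.continuous.aestronglyMeasurable.mul hI.aestronglyMeasurable
    · refine Eventually.of_forall fun x => ?_
      rw [Real.norm_eq_abs, abs_mul, abs_of_nonneg (show 0 ≤ cutoff r n x from Real.smoothTransition.nonneg _)]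
      exact mul_le_of_le_one_left (abs_nonneg _) (Real.smoothTransition.le_one _)
    · filter_upwards [ae_restrict_mem hΩ.measurableSet] with x hx
      rw [hΩr] at hx
      have hx0 : 0 < -r x := neg_pos.2 hx
      refine tendsto_const_nhds.congr' ?_
      filter_upwards [(tendsto_natCast_atTop_atTop (R := ℝ)).eventually_ge_atTop (2 / -r x)]
        with n hn
      rw [div_le_iff₀ hx0] at hn
      rw [cutoff, Real.smoothTransition.one_of_one_le (by nlinarith), one_mul]
  refine (tendsto_finsetSum Finset.univ fun j _ => key j).congr fun n => ?_
  rw [← integral_finsetSum _ fun j _ => hint n j]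
  refine integral_congr_ae (Eventually.of_forall fun x => ?_)
  simp only [fderiv_cutoff hr, smul_apply, smul_eq_mul, neg_mul, neg_neg]
  rw [Finset.mul_sum, Finset.sum_mul]
  exact Finset.sum_congr rfl fun j _ => by ring

/-- The boundary integral of `w z Z·ν` vanishes if `Z` is tangential. -/
lemma sum_bdryForm_eq_zero_of_tangential (hΩ : IsOpen Ω) (hb : Bornology.IsBounded Ω)
    (hr : ContDiff ℝ (⊤ : ℕ∞) r) (hΩr : Ω = {x | r x < 0}) {Z w' z' : Fin d → E d → ℝ}
    {w z : E d → ℝ} (hZ : ∀ j, C1Bdd Ω (Z j)) (hw : ∀ j, WeakPartial Ω j w (w' j))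
    (hz : ∀ j, WeakPartial Ω j z (z' j))
    (ht : ∀ x ∈ Ω, ∑ j, fderiv ℝ r x (basisVec j) * Z j x = 0) :
    ∑ j, bdryForm Ω j (Z j) w (w' j) z (z' j) = 0 := by
  refine tendsto_nhds_unique (tendsto_cutoff_bdryForm hΩ hb hr hΩr hZ hw hz)
    (tendsto_const_nhds.congr fun n => ?_)
  refine Eq.symm (setIntegral_eq_zero_of_forall_eq_zero fun x hx => ?_)
  rw [ht x hx]
  ring

/-- The boundary integral of `w² Z·ν` is nonnegative if `Z` points outwards. -/
lemma sum_bdryForm_nonneg_of_outward (hΩ : IsOpen Ω) (hb : Bornology.IsBounded Ω)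
    (hr : ContDiff ℝ (⊤ : ℕ∞) r) (hΩr : Ω = {x | r x < 0}) {Z w' : Fin d → E d → ℝ}
    {w : E d → ℝ} (hZ : ∀ j, C1Bdd Ω (Z j)) (hw : ∀ j, WeakPartial Ω j w (w' j)) {δ : ℝ}
    (hδ : 0 < δ) (ht : ∀ x ∈ Ω, -δ < r x → 0 ≤ ∑ j, fderiv ℝ r x (basisVec j) * Z j x) :
    0 ≤ ∑ j, bdryForm Ω j (Z j) w (w' j) w (w' j) := by
  refine ge_of_tendsto (tendsto_cutoff_bdryForm hΩ hb hr hΩr hZ hw hw) ?_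
  -- Once `n δ ≥ 2`, the cutoff is constantly `1` near every point with `r ≤ -δ`, so only the layer
  -- where `ht` applies contributes.
  filter_upwards [(tendsto_natCast_atTop_atTop (R := ℝ)).eventually_ge_atTop (2 / δ)] with n hn
  rw [div_le_iff₀ hδ] at hn
  refine setIntegral_nonneg hΩ.measurableSet fun x hx => ?_
  refine mul_nonneg ?_ (mul_self_nonneg _)
  rcases lt_or_ge (-δ) (r x) with h | h
  · exact mul_nonneg (mul_nonneg (by positivity) Real.smoothTransition.monotone.deriv_nonneg)
      (ht x hx h)
  · have : deriv Real.smoothTransition (-((n : ℝ) + 1) * r x - 1) = 0 := by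
      have hev : Real.smoothTransition =ᶠ[𝓝 (-((n : ℝ) + 1) * r x - 1)] fun _ => 1 := by
        filter_upwards [lt_mem_nhds (a := 1) (b := -((n : ℝ) + 1) * r x - 1) (by nlinarith)]
          with t ht
        exact Real.smoothTransition.one_of_one_le ht.le
      rw [hev.deriv_eq]; simp
    rw [this]; simp

end cutoff

/-! ### The sign of the boundary term -/

section boundaryInequality

variable {Ω : Set (E d)} {r : E d → ℝ}

lemma bdryForm_sum_right {ι : Type*} (s : Finset ι) {j : Fin d} {ζ w w' : E d → ℝ}
    {f f' : ι → E d → ℝ} (hΩ : IsOpen Ω) (hζ : C1Bdd Ω ζ) (hw : WeakPartial Ω j w w')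
    (hf : ∀ k ∈ s, WeakPartial Ω j (f k) (f' k)) :
    bdryForm Ω j ζ w w' (fun x => ∑ k ∈ s, f k x) (fun x => ∑ k ∈ s, f' k x)
      = ∑ k ∈ s, bdryForm Ω j ζ w w' (f k) (f' k) := by
  classical
  induction s using Finset.induction_on with
  | empty => simp [bdryForm]
  | insert a s ha ih =>
    simp only [Finset.sum_insert ha]
    rw [bdryForm_add_right hΩ hζ hw (hf a (Finset.mem_insert_self a s))
      (WeakPartial.sum s fun k hk => hf k (Finset.mem_insert_of_mem hk)),
      ih fun k hk => hf k (Finset.mem_insert_of_mem hk)]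

/-- `bdryForm` only sees the boundary values, in the sense of traces, of its arguments. -/
lemma bdryForm_eq_zero_of_trace (hΩ : IsOpen Ω) (hb : Bornology.IsBounded Ω) {j : Fin d}
    {ζ w w' s h k : E d → ℝ} {s' : Fin d → E d → ℝ} (hζ : C1Bdd Ω ζ) (hw : WeakPartial Ω j w w')
    (hs : ∀ i, WeakPartial Ω i s (s' i)) (hh : ContDiff ℝ 1 h) (h0 : ∀ x ∈ frontier Ω, h x = 0)
    (hk : MemH10 Ω k) (hsk : ∀ x, s x = h x - k x) : bdryForm Ω j ζ w w' s (s' j) = 0 := by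
  have hhw : ∀ i, WeakPartial Ω i h fun x => fderiv ℝ h x (basisVec i) := fun i =>
    WeakPartial.of_contDiff hb hh
  have hkw : ∀ i, WeakPartial Ω i k fun x => fderiv ℝ h x (basisVec i) - s' i x := fun i => by
    have := (hhw i).sub (hs i)
    rwa [show (fun x => h x - s x) = k from funext fun x => by rw [hsk]; ring] at this
  have hk0 := bdryForm_eq_zero_of_memH10 (i := j) hΩ hb hk hkw hζ hw
  have hh0 : bdryForm Ω j ζ w w' h (fun x => fderiv ℝ h x (basisVec j)) = 0 := by
    have hhb : C1Bdd Ω h := C1Bdd.of_contDiff hb hh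
    -- Reading `h` as `h · 1`, the factor `h` moves into the weight, where its vanishing on the
    -- frontier can be used.
    have := bdryForm_eq_zero_of_frontier hΩ hb hζ hhb hh.continuous.continuousOn h0 hw
      (WeakPartial.one (i := j) hb)
    rw [bdryForm_mul hΩ hζ hhb] at this
    simpa using this
  have hadd := bdryForm_add_right hΩ hζ hw (hs j) (hkw j)
  simp only [add_sub_cancel] at hadd
  rw [show (fun x => s x + k x) = h from funext fun x => by rw [hsk]; ring, hh0, hk0] at hadd
  linarith

lemma eq_zero_of_mem_frontier (hΩ : IsOpen Ω) (hr : Continuous r) (hΩr : Ω = {x | r x < 0})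
    {x : E d} (hx : x ∈ frontier Ω) : r x = 0 := by
  refine le_antisymm ?_ ?_
  · have : closure Ω ⊆ {x | r x ≤ 0} :=
      closure_minimal (by rw [hΩr]; exact fun y (hy : r y < 0) => (le_of_lt hy : r y ≤ 0)) (isClosed_le hr continuous_const)
    exact this hx.1
  · have h : x ∉ Ω := fun h => hx.2 (by rwa [hΩ.interior_eq])
    rw [hΩr] at h
    exact not_lt.1 h

lemma sum_fderiv_sq (r : E d → ℝ) (x : E d) :
    ∑ j, fderiv ℝ r x (basisVec j) ^ 2 = ‖gradient r x‖ ^ 2 := by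
  rw [EuclideanSpace.norm_sq_eq]
  simp [gradient_apply]

/-- A continuous function positive on the boundary is positive near the boundary. -/
lemma exists_pos_near_frontier (hΩ : IsOpen Ω) (hb : Bornology.IsBounded Ω) (hr : Continuous r)
    (hΩr : Ω = {x | r x < 0}) {b : E d → ℝ} (hbc : Continuous b)
    (hpos : ∀ x ∈ frontier Ω, 0 < b x) : ∃ δ > 0, ∀ x ∈ Ω, -δ < r x → 0 < b x := by
  have hK : IsCompact (closure Ω ∩ {x | b x ≤ 0}) :=
    hb.isCompact_closure.inter_right (isClosed_le hbc continuous_const)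
  rcases (closure Ω ∩ {x | b x ≤ 0}).eq_empty_or_nonempty with he | hne
  · refine ⟨1, one_pos, fun x hx _ => ?_⟩
    by_contra h
    have : x ∈ closure Ω ∩ {x | b x ≤ 0} := ⟨subset_closure hx, not_lt.1 h⟩
    rw [he] at this
    exact this
  · obtain ⟨y, hy, hmax⟩ := hK.exists_isMaxOn hne hr.continuousOn
    have hyΩ : y ∈ Ω := by
      by_contra h
      exact absurd (hpos y ⟨hy.1, by rwa [hΩ.interior_eq]⟩) (not_lt.2 hy.2)
    have hry : r y < 0 := by rw [hΩr] at hyΩ; exact hyΩ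
    refine ⟨-r y, neg_pos.2 hry, fun x hx hrx => ?_⟩
    by_contra h
    have : r x ≤ r y := hmax ⟨subset_closure hx, not_lt.1 h⟩
    linarith

/-- If the normal component `q·ν` equals `-α w` on the boundary in the sense of traces, then
`∫_Ω div(ω w q) ≤ 0`. -/
lemma sum_bdryForm_nonpos (hΩ : IsOpen Ω) (hb : Bornology.IsBounded Ω)
    (hr : ContDiff ℝ (⊤ : ℕ∞) r) (hΩr : Ω = {x | r x < 0})
    (hgrad : ∀ x ∈ frontier Ω, gradient r x ≠ 0) {N : E d → E d} (hN : ContDiff ℝ 1 N)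
    (hNr : ∀ x ∈ frontier Ω, N x = ‖gradient r x‖⁻¹ • gradient r x) {ω w h k : E d → ℝ}
    {w' q : Fin d → E d → ℝ} {q' : Fin d → Fin d → E d → ℝ} {α : ℝ} (hα : 0 ≤ α)
    (hω : C1Bdd Ω ω) (hω0 : ∀ x ∈ Ω, 0 ≤ ω x) (hw : ∀ j, WeakPartial Ω j w (w' j))
    (hq : ∀ i j, WeakPartial Ω j (q i) (q' i j)) (hh : ContDiff ℝ 1 h)
    (h0 : ∀ x ∈ frontier Ω, h x = 0) (hk : MemH10 Ω k)
    (hs : ∀ x, ∑ i, N x i * q i x + α * w x = h x - k x) :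
    ∑ j, bdryForm Ω j ω w (w' j) (q j) (q' j j) ≤ 0 := by
  let a : Fin d → E d → ℝ := fun j x => fderiv ℝ r x (basisVec j)
  let S : E d → ℝ := fun x => ∑ j, a j x ^ 2
  let n : Fin d → E d → ℝ := fun j x => N x j
  -- On the boundary this is `1/|∇r|²`. The term `r²` keeps the denominator positive at interior
  -- critical points of `r`.
  let κ : E d → ℝ := fun x => (S x + r x ^ 2)⁻¹
  have ha : ∀ j, ContDiff ℝ 1 (a j) := fun j =>
    ((hr.fderiv_right (m := (⊤ : ℕ∞)) le_rfl).clm_apply contDiff_const).of_le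
      (by exact_mod_cast le_top)
  have hr1 : ContDiff ℝ 1 r := hr.of_le (by exact_mod_cast le_top)
  have hS : ContDiff ℝ 1 S := ContDiff.sum fun j _ => (ha j).pow 2
  have hn : ∀ j, ContDiff ℝ 1 (n j) := fun j =>
    (EuclideanSpace.proj (𝕜 := ℝ) j : E d →L[ℝ] ℝ).contDiff.comp hN
  have hS0 : ∀ x, 0 ≤ S x := fun x => Finset.sum_nonneg fun j _ => sq_nonneg _
  have hSf : ∀ x ∈ frontier Ω, 0 < S x := fun x hx => by
    have : S x = ‖gradient r x‖ ^ 2 := sum_fderiv_sq r x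
    rw [this]
    have := norm_pos_iff.2 (hgrad x hx)
    positivity
  have hκc : ∀ x ∈ closure Ω, ContDiffAt ℝ 1 κ x := fun x hx => by
    refine (hS.add (hr1.pow 2)).contDiffAt.inv (ne_of_gt ?_)
    by_cases hxΩ : x ∈ Ω
    · have : r x ≠ 0 := by rw [hΩr] at hxΩ; exact ne_of_lt hxΩ
      exact add_pos_of_nonneg_of_pos (hS0 x) (by positivity)
    · have := hSf x ⟨hx, by rwa [hΩ.interior_eq]⟩
      positivity
  have hκ : C1Bdd Ω κ := C1Bdd.of_contDiffAt_closure hb hκc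
  have hnb : ∀ j, C1Bdd Ω (n j) := fun j => C1Bdd.of_contDiff hb (hn j)
  have hna : ∀ x ∈ frontier Ω, ∀ j, n j x = ‖gradient r x‖⁻¹ * a j x := fun x hx j => by
    simp only [n, a, hNr x hx, ← gradient_apply, PiLp.smul_apply, smul_eq_mul]
  -- Only the normal part of `q` matters. Write `δᵢⱼ = τᵢⱼ + tᵢⱼ + nᵢ nⱼ`, where `t` is a multiple
  -- of the tangential projection `|∇r|² δᵢⱼ - ∂ᵢr ∂ⱼr`, so that `∇r·tᵢ = 0` in all of `Ω`. On the
  -- boundary `t` equals `δ - ν ⊗ ν`, so `τ` vanishes there; both contributions drop out.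
  have step1 : ∀ i, bdryForm Ω i ω w (w' i) (q i) (q' i i)
      = ∑ j, bdryForm Ω j (fun x => ω x * n j x * n i x) w (w' j) (q i) (q' i j) := fun i => by
    let t : Fin d → E d → ℝ := fun j x => κ x * (S x * (if i = j then 1 else 0) - a i x * a j x)
    let τ : Fin d → E d → ℝ := fun j x => (if i = j then 1 else 0) - n i x * n j x - t j x
    have htc : ∀ j, ∀ x ∈ closure Ω, ContDiffAt ℝ 1 (t j) x := fun j x hx =>
      (hκc x hx).mul ((hS.mul contDiff_const).sub ((ha i).mul (ha j))).contDiffAt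
    have hτc : ∀ j, ∀ x ∈ closure Ω, ContDiffAt ℝ 1 (τ j) x := fun j x hx =>
      ((contDiff_const.sub ((hn i).mul (hn j))).contDiffAt).sub (htc j x hx)
    have htb : ∀ j, C1Bdd Ω (t j) := fun j => C1Bdd.of_contDiffAt_closure hb (htc j)
    have hτb : ∀ j, C1Bdd Ω (τ j) := fun j => C1Bdd.of_contDiffAt_closure hb (hτc j)
    have hτ0 : ∀ j, ∀ x ∈ frontier Ω, τ j x = 0 := fun j x hx => by
      have e1 : r x = 0 := eq_zero_of_mem_frontier hΩ hr1.continuous hΩr hx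
      have e2 : S x = ‖gradient r x‖ ^ 2 := sum_fderiv_sq r x
      have e3 : ‖gradient r x‖ ≠ 0 := norm_ne_zero_iff.2 (hgrad x hx)
      simp only [τ, t, κ, hna x hx, e1, e2]
      field_simp
      ring
    have z1 : ∀ j, bdryForm Ω j (fun x => ω x * τ j x) w (w' j) (q i) (q' i j) = 0 := fun j =>
      bdryForm_eq_zero_of_frontier hΩ hb hω (hτb j)
        (fun x hx => (hτc j x hx).continuousAt.continuousWithinAt) (hτ0 j) (hw j) (hq i j)
    have z2 : ∑ j, bdryForm Ω j (fun x => ω x * t j x) w (w' j) (q i) (q' i j) = 0 := by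
      refine sum_bdryForm_eq_zero_of_tangential hΩ hb hr hΩr (fun j => hω.mul (htb j) hΩ) hw
        (hq i) fun x _ => ?_
      have : ∀ j, fderiv ℝ r x (basisVec j) * (ω x * t j x)
          = ω x * κ x * (S x * (if i = j then a j x else 0)) - ω x * κ x * a i x * a j x ^ 2 := by
        intro j
        simp only [t, a]
        split_ifs <;> ring
      rw [Finset.sum_congr rfl fun j _ => this j, Finset.sum_sub_distrib, ← Finset.mul_sum,
        ← Finset.mul_sum, ← Finset.mul_sum, Finset.sum_ite_eq]
      simp only [Finset.mem_univ, if_true, S]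
      ring
    have hsplit : ∀ j, bdryForm Ω j (fun x => ω x * (if i = j then 1 else 0)) w (w' j) (q i) (q' i j)
        = bdryForm Ω j (fun x => ω x * τ j x) w (w' j) (q i) (q' i j)
          + bdryForm Ω j (fun x => ω x * t j x) w (w' j) (q i) (q' i j)
          + bdryForm Ω j (fun x => ω x * n j x * n i x) w (w' j) (q i) (q' i j) := fun j => by
      rw [← bdryForm_add hΩ (hω.mul (hτb j) hΩ) (hω.mul (htb j) hΩ) (hw j) (hq i j),
        ← bdryForm_add hΩ ((hω.mul (hτb j) hΩ).add (hω.mul (htb j) hΩ) hΩ)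
          ((hω.mul (hnb j) hΩ).mul (hnb i) hΩ) (hw j) (hq i j)]
      congr 1
      funext x
      simp only [τ]
      ring
    have hdelta : ∀ j, bdryForm Ω j (fun x => ω x * (if i = j then 1 else 0)) w (w' j) (q i) (q' i j)
        = if i = j then bdryForm Ω i ω w (w' i) (q i) (q' i i) else 0 := fun j => by
      split_ifs with hij
      · subst hij
        simp
      · simp [bdryForm]
    have hsum := Finset.sum_congr (rfl : (Finset.univ : Finset (Fin d)) = Finset.univ)
      fun j _ => hsplit j
    simp only [hdelta, Finset.sum_ite_eq, Finset.mem_univ, if_true, z1, zero_add,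
      Finset.sum_add_distrib, z2] at hsum
    exact hsum
  let s : E d → ℝ := fun x => ∑ i, n i x * q i x
  let s' : Fin d → E d → ℝ := fun j x =>
    ∑ i, (n i x * q' i j x + fderiv ℝ (n i) x (basisVec j) * q i x)
  have hnq : ∀ i j, WeakPartial Ω j (fun x => n i x * q i x)
      (fun x => n i x * q' i j x + fderiv ℝ (n i) x (basisVec j) * q i x) := fun i j =>
    (hq i j).mul hΩ hb (hnb i)
  have hsw : ∀ j, WeakPartial Ω j s (s' j) := fun j =>
    WeakPartial.sum Finset.univ fun i _ => hnq i j
  have step2 : ∑ j, bdryForm Ω j ω w (w' j) (q j) (q' j j)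
      = ∑ j, bdryForm Ω j (fun x => ω x * n j x) w (w' j) s (s' j) := by
    rw [Finset.sum_congr rfl fun i _ => step1 i, Finset.sum_comm]
    refine Finset.sum_congr rfl fun j _ => ?_
    rw [bdryForm_sum_right Finset.univ hΩ (hω.mul (hnb j) hΩ) (hw j) fun i _ => hnq i j]
    exact Finset.sum_congr rfl fun i _ => bdryForm_mul hΩ (hω.mul (hnb j) hΩ) (hnb i)
  -- In the sense of traces `N·q + α w = 0`, so `N·q` may be replaced by `-α w`.
  have step3 : ∀ j, bdryForm Ω j (fun x => ω x * n j x) w (w' j) s (s' j)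
      = -(α * bdryForm Ω j (fun x => ω x * n j x) w (w' j) w (w' j)) := fun j => by
    have hωn := hω.mul (hnb j) hΩ
    have h1 := bdryForm_eq_zero_of_trace (j := j) (s := fun x => s x + α * w x)
      (s' := fun i x => s' i x + α * w' i x) hΩ hb hωn (hw j)
      (fun i => (hsw i).add ((hw i).const_mul α)) hh h0 hk hs
    rw [bdryForm_add_right hΩ hωn (hw j) (hsw j) ((hw j).const_mul α),
      bdryForm_const_mul_right] at h1
    linarith
  obtain ⟨δ, hδ, hpos⟩ := exists_pos_near_frontier hΩ hb hr1.continuous hΩr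
    (b := fun x => ∑ j, a j x * n j x)
    (continuous_finsetSum _ fun j _ => (ha j).continuous.mul (hn j).continuous) fun x hx => by
      have e2 : S x = ‖gradient r x‖ ^ 2 := sum_fderiv_sq r x
      have e3 : ‖gradient r x‖ ≠ 0 := norm_ne_zero_iff.2 (hgrad x hx)
      have : ∑ j, a j x * n j x = ‖gradient r x‖⁻¹ * S x := by
        simp only [S, Finset.mul_sum]
        exact Finset.sum_congr rfl fun j _ => by rw [hna x hx]; ring
      rw [this]
      exact mul_pos (inv_pos.2 (norm_pos_iff.2 (hgrad x hx))) (hSf x hx)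
  have step4 := sum_bdryForm_nonneg_of_outward hΩ hb hr hΩr (fun j => hω.mul (hnb j) hΩ) hw hδ
    fun x hx hrx => by
      have : ∑ j, fderiv ℝ r x (basisVec j) * (ω x * n j x) = ω x * ∑ j, a j x * n j x := by
        rw [Finset.mul_sum]
        exact Finset.sum_congr rfl fun j _ => by simp only [a]; ring
      rw [this]
      exact mul_nonneg (hω0 x hx) (hpos x hx hrx).le
  rw [step2, Finset.sum_congr rfl fun j _ => step3 j, Finset.sum_neg_distrib, ← Finset.mul_sum]
  exact neg_nonpos.2 (mul_nonneg hα step4)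

end boundaryInequality

/-! ### A priori bounds for the network class -/

section network

/-- The properties of the activation functions that matter for a priori bounds. -/
structure TameActivation (ρ : ℝ → ℝ) : Prop where
  contDiff : ContDiff ℝ 1 ρ
  abs_le_one : ∀ t, |ρ t| ≤ 1
  lipschitz : ∀ s t, |ρ s - ρ t| ≤ |s - t|

lemma TameActivation.of_deriv {ρ ρ' : ℝ → ℝ} (hc : ContDiff ℝ 1 ρ) (h1 : ∀ t, |ρ t| ≤ 1)
    (hd : ∀ t, HasDerivAt ρ (ρ' t) t) (hb : ∀ t, |ρ' t| ≤ 1) : TameActivation ρ := by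
  refine ⟨hc, h1, fun s t => ?_⟩
  have h : LipschitzWith 1 ρ := lipschitzWith_of_nnnorm_deriv_le (fun t => (hd t).differentiableAt)
    fun t => by
      rw [(hd t).deriv, ← NNReal.coe_le_coe]
      simpa using hb t
  simpa [Real.dist_eq] using h.dist_le_mul s t

lemma tameActivation_sigmoid : TameActivation Real.sigmoid := by
  refine TameActivation.of_deriv (contDiff_sigmoid.of_le le_top) (fun t => ?_)
    Real.hasDerivAt_sigmoid fun t => ?_
  · rw [abs_of_nonneg (Real.sigmoid_nonneg t)]
    exact Real.sigmoid_le_one t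
  · have h0 := Real.sigmoid_nonneg t
    have h1 := Real.sigmoid_le_one t
    rw [abs_le]
    constructor <;> nlinarith

lemma tameActivation_tanh : TameActivation Real.tanh := by
  have he : Real.tanh = fun t => Real.sinh t / Real.cosh t := funext Real.tanh_eq_sinh_div_cosh
  refine TameActivation.of_deriv (ρ' := fun t => 1 - Real.tanh t ^ 2) ?_
    (fun t => (Real.abs_tanh_lt_one t).le) (fun t => ?_) fun t => ?_
  · rw [he]
    exact Real.contDiff_sinh.div Real.contDiff_cosh fun t => (Real.cosh_pos t).ne'
  · have h := (Real.hasDerivAt_sinh t).div (Real.hasDerivAt_cosh t) (Real.cosh_pos t).ne'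
    rw [he]
    refine h.congr_deriv ?_
    have := (Real.cosh_pos t).ne'
    field_simp
  · have := Real.tanh_sq_lt_one t
    rw [abs_le]
    constructor <;> nlinarith [sq_nonneg (Real.tanh t)]

/-- Hidden widths are arbitrary, so row sums are bounded by the number of nonzero weights rather
than by the number of columns. -/
lemma sum_abs_row_le {m m' n : ℕ} {B : ℝ} (hB : 0 ≤ B) (A : Matrix (Fin m') (Fin m) ℝ)
    (hn : Set.ncard {ij : Fin m' × Fin m | A ij.1 ij.2 ≠ 0} ≤ n) (hA : ∀ i j, |A i j| ≤ B)
    (i : Fin m') : ∑ j, |A i j| ≤ n * B := by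
  classical
  have h1 : ∑ j, |A i j| = ∑ j with A i j ≠ 0, |A i j| := by
    rw [Finset.sum_filter]
    refine Finset.sum_congr rfl fun j _ => ?_
    split_ifs with h
    · rfl
    · simp [not_not.1 h]
  have h2 : (Finset.univ.filter fun j => A i j ≠ 0).card ≤ n := by
    refine le_trans ?_ hn
    rw [← Set.ncard_coe_finset]
    refine Set.ncard_le_ncard_of_injOn (fun j => (i, j)) (fun j hj => ?_)
      (fun j _ j' _ h => (Prod.mk.inj h).2) (Set.toFinite _)
    simpa using hj
  rw [h1]
  calc ∑ j with A i j ≠ 0, |A i j| ≤ ∑ j with A i j ≠ 0, B := Finset.sum_le_sum fun j _ => hA i j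
    _ = (Finset.univ.filter fun j => A i j ≠ 0).card * B := by rw [Finset.sum_const, nsmul_eq_mul]
    _ ≤ n * B := by gcongr

lemma abs_mulVec_le {m m' : ℕ} {c M : ℝ} (A : Matrix (Fin m') (Fin m) ℝ) (v : Fin m → ℝ)
    (i : Fin m') (hA : ∑ j, |A i j| ≤ c) (hM : 0 ≤ M) (hv : ∀ j, |v j| ≤ M) :
    |A.mulVec v i| ≤ c * M := by
  calc |A.mulVec v i| = |∑ j, A i j * v j| := rfl
    _ ≤ ∑ j, |A i j * v j| := Finset.abs_sum_le_sum_abs _ _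
    _ ≤ ∑ j, |A i j| * M := Finset.sum_le_sum fun j _ => by
        rw [abs_mul]; gcongr; exact hv j
    _ ≤ c * M := by rw [← Finset.sum_mul]; gcongr

lemma contDiff_mulVec {m m' : ℕ} (A : Matrix (Fin m') (Fin m) ℝ) {v : E d → Fin m → ℝ}
    (hv : ∀ j, ContDiff ℝ 1 fun x => v x j) (i : Fin m') :
    ContDiff ℝ 1 fun x => A.mulVec (v x) i :=
  (ContDiff.sum fun j _ => contDiff_const.mul (hv j) :
    ContDiff ℝ 1 fun x => ∑ j, A i j * v x j)

variable {ρ : ℝ → ℝ} {n : ℕ} {B R : ℝ}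

/-- The bound `R` survives every layer because activations are at most `1 ≤ R`. Activations are
1-Lipschitz, so each layer multiplies the Lipschitz constant by at most the row sum `n B`. -/
lemma Network.hidden_bounds (hρ : TameActivation ρ) (hB : 0 ≤ B) (hR : 1 ≤ R) :
    ∀ {D m : ℕ} (net : Network d D m), net.numNonzero ≤ n → net.WeightsBounded B →
      (∀ i, ContDiff ℝ 1 fun x => net.hidden ρ x i) ∧
      (∀ x, ‖x‖ ≤ R → ∀ i, |net.hidden ρ x i| ≤ R) ∧
      ∀ x y i, |net.hidden ρ x i - net.hidden ρ y i| ≤ (n * B) ^ D * ‖x - y‖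
  | _, _, .input, _, _ => by
    refine ⟨fun i => (EuclideanSpace.proj (𝕜 := ℝ) i : E d →L[ℝ] ℝ).contDiff, fun x hx i => ?_,
      fun x y i => ?_⟩
    · exact (PiLp.norm_apply_le x i).trans hx
    · simpa [Network.hidden] using PiLp.norm_apply_le (x - y) i
  | _, _, .layer net m' A b, hn, hw => by
    simp only [Network.numNonzero] at hn
    obtain ⟨hw1, hA, hb⟩ := hw
    obtain ⟨h1, h2, h3⟩ := Network.hidden_bounds hρ hB hR net (by omega) hw1
    have hrow := sum_abs_row_le (n := n) hB A (by omega) hA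
    refine ⟨fun i => ?_, fun x _ i => (hρ.abs_le_one _).trans hR, fun x y i => ?_⟩
    · exact hρ.contDiff.comp ((contDiff_mulVec A h1 i).add contDiff_const)
    · refine (hρ.lipschitz _ _).trans ?_
      have := abs_mulVec_le A (net.hidden ρ x - net.hidden ρ y) i (hrow i) (by positivity)
        (fun j => h3 x y j)
      rw [Matrix.mulVec_sub] at this
      simp only [Pi.add_apply, add_sub_add_right_eq_sub]
      refine this.trans (le_of_eq ?_)
      ring

lemma Network.realize_bounds (hρ : TameActivation ρ) (hR : 1 ≤ R) :
    ∀ {D m : ℕ} (net : Network d D m), 1 ≤ D → 1 ≤ m → net.numNonzero ≤ n →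
      net.WeightsBounded B → 0 ≤ B ∧
      (∀ i, ContDiff ℝ 1 fun x => net.realize ρ x i) ∧
      (∀ x, ‖x‖ ≤ R → ∀ i, |net.realize ρ x i| ≤ n * B * R + B) ∧
      ∀ x y i, |net.realize ρ x i - net.realize ρ y i| ≤ (n * B) ^ D * ‖x - y‖
  | _, _, .layer net m' A b, _, hm, hn, hw => by
    simp only [Network.numNonzero] at hn
    obtain ⟨hw1, hA, hb⟩ := hw
    -- The output layer is nonempty, so it has a bias entry, which forces `B ≥ 0`.
    have hB : 0 ≤ B := (abs_nonneg _).trans (hb ⟨0, hm⟩)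
    obtain ⟨h1, h2, h3⟩ := Network.hidden_bounds (n := n) hρ hB hR net (by omega) hw1
    have hrow := sum_abs_row_le (n := n) hB A (by omega) hA
    refine ⟨hB, fun i => ?_, fun x hx i => ?_, fun x y i => ?_⟩
    · exact (contDiff_mulVec A h1 i).add contDiff_const
    · exact (abs_add_le _ _).trans
        (add_le_add (abs_mulVec_le A _ i (hrow i) (by linarith) (h2 x hx)) (hb i))
    · have := abs_mulVec_le A (net.hidden ρ x - net.hidden ρ y) i (hrow i) (by positivity)
        (fun j => h3 x y j)
      rw [Matrix.mulVec_sub] at this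
      simp only [Network.realize, Pi.add_apply, add_sub_add_right_eq_sub]
      refine this.trans (le_of_eq ?_)
      ring

/-- The pairs in `𝒫` are `C¹`, and uniformly bounded with their derivatives on bounded sets. -/
lemma exists_bound_modifiedClass {Ω : Set (E d)} (hb : Bornology.IsBounded Ω)
    (hρ : TameActivation ρ) {D : ℕ} (hD : 1 ≤ D) (n : ℕ) (B : ℝ)
    {φ : E d × (Fin (d + 1) → ℝ) → (Fin (d + 1) → ℝ)} (hφ : ContDiff ℝ 1 φ) :
    ∃ K, ∀ v ∈ modifiedClass ρ D n B φ, ContDiff ℝ 1 v.1 ∧ ContDiff ℝ 1 v.2 ∧ ∀ x ∈ Ω,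
      |v.1 x| ≤ K ∧ ‖v.2 x‖ ≤ K ∧ ‖gradient v.1 x‖ ≤ K ∧ |divergence v.2 x| ≤ K := by
  obtain ⟨R₀, hR₀⟩ := hb.exists_norm_le
  set R := max R₀ 1
  set M := n * B * R + B
  set L := (n * B) ^ D
  -- All points `(x, F x)` with `x ∈ Ω` and `F` in the class stay in this one compact set, so `φ`
  -- and its derivative are bounded uniformly.
  have hK : IsCompact (Metric.closedBall (0 : E d) R ×ˢ
      Metric.closedBall (0 : Fin (d + 1) → ℝ) M) :=
    (isCompact_closedBall _ _).prod (isCompact_closedBall _ _)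
  obtain ⟨a, ha⟩ := hK.exists_bound_of_continuousOn hφ.continuous.continuousOn
  obtain ⟨b, hb'⟩ := hK.exists_bound_of_continuousOn
    (hφ.continuous_fderiv one_ne_zero).continuousOn
  -- The first entry bounds the values, with `|p|` estimated by the sum of its `d` coordinates. The
  -- second bounds gradient and divergence by the chain rule, `max 1 L` being the bound for the
  -- derivative of `x ↦ (x, F x)`.
  refine ⟨max (a + d * a) ((1 + d) * (b * max 1 L)), ?_⟩
  rintro _ ⟨F, ⟨net, hn, hw, rfl⟩, rfl⟩
  obtain ⟨hB, h1, h2, h3⟩ := net.realize_bounds hρ (le_max_right R₀ 1) hD (by omega) hn hw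
  set F := net.realize ρ
  have hL : 0 ≤ L := by positivity
  have hM : 0 ≤ M := by
    have : 0 ≤ R := zero_le_one.trans (le_max_right R₀ 1)
    positivity
  have hF : ContDiff ℝ 1 F := contDiff_pi.2 h1
  have hΦ : ContDiff ℝ 1 fun x => φ (x, F x) := hφ.comp (contDiff_id.prodMk hF)
  have hcoord : ∀ i, ContDiff ℝ 1 fun x => φ (x, F x) i := fun i => contDiff_pi.1 hΦ i
  have hFd : ∀ x, ‖fderiv ℝ F x‖ ≤ L := fun x => by
    refine norm_fderiv_le_of_lip' ℝ hL (Eventually.of_forall fun y => ?_)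
    rw [pi_norm_le_iff_of_nonneg (by positivity)]
    exact fun i => h3 y x i
  have hmem : ∀ x ∈ Ω, (x, F x) ∈ Metric.closedBall (0 : E d) R ×ˢ
      Metric.closedBall (0 : Fin (d + 1) → ℝ) M := fun x hx => by
    have hxR : ‖x‖ ≤ R := (hR₀ x hx).trans (le_max_left _ _)
    refine ⟨mem_closedBall_zero_iff.2 hxR, mem_closedBall_zero_iff.2 ?_⟩
    exact (pi_norm_le_iff_of_nonneg hM).2 fun i => h2 x hxR i
  have hval : ∀ x ∈ Ω, ∀ i, |φ (x, F x) i| ≤ a := fun x hx i =>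
    (norm_le_pi_norm (φ (x, F x)) i).trans (ha _ (hmem x hx))
  have hder : ∀ x ∈ Ω, ∀ i, ‖fderiv ℝ (fun x => φ (x, F x) i) x‖ ≤ b * max 1 L := fun x hx i => by
    have hFx := (hF.differentiable one_ne_zero x).hasFDerivAt
    have h := (hφ.differentiable one_ne_zero (x, F x)).hasFDerivAt.comp x
      ((hasFDerivAt_id x).prodMk hFx)
    have h' := (ContinuousLinearMap.proj (R := ℝ) (φ := fun _ : Fin (d + 1) => ℝ) i).hasFDerivAt.comp
      x h
    rw [show fderiv ℝ (fun x => φ (x, F x) i) x = _ from h'.fderiv]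
    have hp : ‖ContinuousLinearMap.proj (R := ℝ) (φ := fun _ : Fin (d + 1) => ℝ) i‖ ≤ 1 :=
      ContinuousLinearMap.opNorm_le_bound _ zero_le_one fun v => by
        simpa using norm_le_pi_norm v i
    have hpr : ‖(ContinuousLinearMap.id ℝ (E d)).prod (fderiv ℝ F x)‖ ≤ max 1 L := by
      rw [ContinuousLinearMap.opNorm_prod]
      exact max_le_max ContinuousLinearMap.norm_id_le (hFd x)
    have hb0 := hb' _ (hmem x hx)
    have hb1 : 0 ≤ b := (norm_nonneg _).trans hb0
    refine (ContinuousLinearMap.opNorm_comp_le _ _).trans ?_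
    refine (mul_le_mul hp (ContinuousLinearMap.opNorm_comp_le _ _) (norm_nonneg _)
      zero_le_one).trans ?_
    rw [one_mul]
    exact mul_le_mul hb0 hpr (norm_nonneg _) hb1
  have hp : ContDiff ℝ 1 (modifiedOutput φ F).2 := contDiff_euclidean.2 fun i => hcoord i.succ
  refine ⟨hcoord 0, hp, fun x hx => ?_⟩
  have ha0 : 0 ≤ a := (abs_nonneg _).trans (hval x hx 0)
  have hb0 : 0 ≤ b * max 1 L := (norm_nonneg _).trans (hder x hx 0)
  have hd0 : (0 : ℝ) ≤ d := Nat.cast_nonneg d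
  refine ⟨?_, ?_, ?_, ?_⟩
  · refine (hval x hx 0).trans (le_trans ?_ (le_max_left _ _))
    nlinarith
  · refine le_trans ?_ (le_max_left _ _)
    have h : ‖(modifiedOutput φ F).2 x‖ ≤ ∑ i : Fin d, |φ (x, F x) i.succ| := by
      rw [EuclideanSpace.norm_eq]
      refine Real.sqrt_le_iff.2 ⟨Finset.sum_nonneg fun i _ => abs_nonneg _, ?_⟩
      exact Finset.sum_sq_le_sq_sum_of_nonneg fun i _ => abs_nonneg _
    refine h.trans ((Finset.sum_le_sum fun i _ => hval x hx i.succ).trans ?_)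
    simp only [Finset.sum_const, Finset.card_univ, Fintype.card_fin, nsmul_eq_mul]
    linarith
  · refine le_trans ?_ (le_max_right _ _)
    have : ‖gradient (modifiedOutput φ F).1 x‖ = ‖fderiv ℝ (fun x => φ (x, F x) 0) x‖ :=
      LinearIsometryEquiv.norm_map _ _
    rw [this]
    refine (hder x hx 0).trans ?_
    nlinarith
  · refine le_trans ?_ (le_max_right _ _)
    have h : ∀ i : Fin d, |fderiv ℝ (modifiedOutput φ F).2 x (basisVec i) i| ≤ b * max 1 L := by
      intro i
      have e := ((EuclideanSpace.proj (𝕜 := ℝ) i : E d →L[ℝ] ℝ).hasFDerivAt.comp x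
        (hp.differentiable one_ne_zero x).hasFDerivAt).fderiv
      have e' : fderiv ℝ (modifiedOutput φ F).2 x (basisVec i) i
          = fderiv ℝ (fun x => φ (x, F x) i.succ) x (basisVec i) := by
        rw [show fderiv ℝ (fun x => φ (x, F x) i.succ) x = _ from e]
        rfl
      rw [e']
      exact (C1Bdd.abs_fderiv_basisVec_le _ i).trans (hder x hx i.succ)
    refine (Finset.abs_sum_le_sum_abs _ _).trans ((Finset.sum_le_sum fun i _ => h i).trans ?_)
    simp only [Finset.sum_const, Finset.card_univ, Fintype.card_fin, nsmul_eq_mul]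
    nlinarith

end network

/-! ### Pointwise bounds for the coefficient -/

section coefficient

variable {Ω : Set (E d)}

/-- An essential bound for the gradient of a `C¹` function holds everywhere. -/
lemma norm_gradient_le_of_eLpNorm (hΩ : IsOpen Ω) {ω : E d → ℝ} (hω : ContDiffOn ℝ 2 ω Ω)
    (hfin : eLpNorm (fun x => gradient ω x) ⊤ (volume.restrict Ω) ≠ ⊤) :
    ∀ x ∈ Ω, ‖gradient ω x‖ ≤ (eLpNorm (fun x => gradient ω x) ⊤ (volume.restrict Ω)).toReal := by
  set T := (eLpNorm (fun x => gradient ω x) ⊤ (volume.restrict Ω)).toReal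
  have hnorm : ∀ x, ‖gradient ω x‖ = ‖fderiv ℝ ω x‖ := fun x => LinearIsometryEquiv.norm_map _ _
  have hae : ∀ᵐ x ∂volume.restrict Ω, ‖fderiv ℝ ω x‖ ≤ T := by
    have h := enorm_ae_le_eLpNormEssSup (fun x => gradient ω x) (volume.restrict Ω)
    rw [← eLpNorm_exponent_top] at h
    filter_upwards [h] with x hx
    rw [← hnorm, ← toReal_enorm]
    exact ENNReal.toReal_mono hfin hx
  intro x hx
  rw [hnorm]
  by_contra hlt
  have hc : ContinuousOn (fun x => ‖fderiv ℝ ω x‖) Ω :=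
    (hω.continuousOn_fderiv_of_isOpen hΩ (by norm_num)).norm
  -- A violation at one point persists on a nonempty open set by continuity of the derivative, and
  -- such a set is not null.
  have ho : IsOpen (Ω ∩ (fun x => ‖fderiv ℝ ω x‖) ⁻¹' Set.Ioi T) :=
    hc.isOpen_inter_preimage hΩ isOpen_Ioi
  have hpos := ho.measure_pos volume ⟨x, hx, not_le.1 hlt⟩
  rw [ae_restrict_iff' hΩ.measurableSet] at hae
  refine hpos.ne' (measure_mono_null (fun y hy => ?_) hae)
  exact fun h => absurd (h hy.1) (not_le.2 hy.2)

/-- Regularity on the open set alone does not bound `ω`. Convexity allows the mean value inequality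
along segments from a fixed point. -/
lemma C1Bdd.of_norm_gradient_le (hΩ : IsOpen Ω) (hconv : Convex ℝ Ω) (hb : Bornology.IsBounded Ω)
    {ω : E d → ℝ} (hω : ContDiffOn ℝ 1 ω Ω) {T : ℝ} (hT : ∀ x ∈ Ω, ‖gradient ω x‖ ≤ T) :
    C1Bdd Ω ω := by
  have hT' : ∀ x ∈ Ω, ‖fderiv ℝ ω x‖ ≤ T := fun x hx => by
    rw [← show ‖gradient ω x‖ = ‖fderiv ℝ ω x‖ from LinearIsometryEquiv.norm_map _ _]
    exact hT x hx
  rcases Ω.eq_empty_or_nonempty with rfl | ⟨x₀, hx₀⟩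
  · exact ⟨hω, 0, fun x hx => hx.elim⟩
  obtain ⟨R, hR⟩ := hb.exists_norm_le
  refine ⟨hω, max (|ω x₀| + T * (R + R)) T, fun x hx => ⟨?_, (hT' x hx).trans (le_max_right _ _)⟩⟩
  refine le_trans ?_ (le_max_left _ _)
  have h := hconv.norm_image_sub_le_of_norm_fderiv_le
    (fun y hy => (hω.contDiffAt (hΩ.mem_nhds hy)).differentiableAt one_ne_zero) hT' hx₀ hx
  have hT0 : 0 ≤ T := (norm_nonneg _).trans (hT' x hx)
  have h2 : ‖x - x₀‖ ≤ R + R := (norm_sub_le _ _).trans (add_le_add (hR x hx) (hR x₀ hx₀))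
  have h3 : |ω x - ω x₀| ≤ T * (R + R) := h.trans (by gcongr)
  have h4 := abs_sub_abs_le_abs_sub (ω x) (ω x₀)
  linarith

end coefficient

/-! ### Coercivity and boundedness of the least-squares functional -/

section leastSquares

variable {Ω : Set (E d)} {ω w : E d → ℝ} {w' q : Fin d → E d → ℝ} {q' : Fin d → Fin d → E d → ℝ}

/-- The density of the least-squares functional of the error `(w, q)`. -/
noncomputable def errorDensity (ω w : E d → ℝ) (w' q : Fin d → E d → ℝ)
    (q' : Fin d → Fin d → E d → ℝ) (x : E d) : ℝ :=
  ω x * ∑ j, (q j x - w' j x) ^ 2 + (-(∑ j, q' j j x) + ω x * w x) ^ 2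

lemma integrable_errorDensity (hΩ : IsOpen Ω) (hω : C1Bdd Ω ω)
    (hw : ∀ j, WeakPartial Ω j w (w' j)) (hw0 : MemLp w 2 (volume.restrict Ω))
    (hq : ∀ i j, WeakPartial Ω j (q i) (q' i j)) :
    Integrable (errorDensity ω w w' q q') (volume.restrict Ω) := by
  have h1 : ∀ j, Integrable (fun x => ω x * (q j x - w' j x) * (q j x - w' j x))
      (volume.restrict Ω) := fun j =>
    have hm : MemLp (fun x => q j x - w' j x) 2 (volume.restrict Ω) :=
      (hq j j).memLp.sub (hw j).memLp_deriv
    integrable_fun_mul (hω.memLp_mul hΩ hm) hm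
  have h2 : MemLp (fun x => -(∑ j, q' j j x) + ω x * w x) 2 (volume.restrict Ω) :=
    (memLp_finsetSum _ fun j _ => (hq j j).memLp_deriv).neg.add (hω.memLp_mul hΩ hw0)
  refine ((integrable_finsetSum Finset.univ fun j _ => h1 j).add h2.integrable_sq).congr
    (Eventually.of_forall fun x => ?_)
  simp only [Pi.add_apply, errorDensity, Finset.mul_sum]
  congr 1
  exact Finset.sum_congr rfl fun j _ => by ring

/-- Coercivity of the least-squares functional. -/
lemma coercive_errorDensity (hΩ : IsOpen Ω) (hω : C1Bdd Ω ω) {c θ : ℝ} (hc : 0 < c)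
    (hθ0 : 0 ≤ θ) (hθ1 : θ < 1) (hcω : ∀ x ∈ Ω, c ≤ ω x)
    (hgrad : ∀ x ∈ Ω, ‖gradient ω x‖ ≤ θ * (c * √c))
    (hw : ∀ j, WeakPartial Ω j w (w' j)) (hw0 : MemLp w 2 (volume.restrict Ω))
    (hq : ∀ i j, WeakPartial Ω j (q i) (q' i j))
    (hbdry : ∑ j, bdryForm Ω j ω w (w' j) (q j) (q' j j) ≤ 0) :
    (1 - θ) * min c (c ^ 2) * ((∫ x in Ω, (w x ^ 2 + ∑ j, w' j x ^ 2)) + ∫ x in Ω, ∑ j, q j x ^ 2)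
      ≤ ∫ x in Ω, errorDensity ω w w' q q' x := by
  have iB : ∀ j, Integrable (fun x => ω x * (w' j x * q j x + w x * q' j j x)
      + fderiv ℝ ω x (basisVec j) * (w x * q j x)) (volume.restrict Ω) := fun j =>
    integrable_bdryForm hΩ hω (hw j) (hq j j)
  have i1 : Integrable (fun x => w x ^ 2 + ∑ j, w' j x ^ 2) (volume.restrict Ω) :=
    hw0.integrable_sq.add (integrable_finsetSum _ fun j _ => (hw j).memLp_deriv.integrable_sq)
  have i2 : Integrable (fun x => ∑ j, q j x ^ 2) (volume.restrict Ω) :=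
    integrable_finsetSum _ fun j _ => (hq j j).memLp.integrable_sq
  have iE := integrable_errorDensity hΩ hω hw hw0 hq
  have iS : Integrable (fun x => ∑ j, (ω x * (w' j x * q j x + w x * q' j j x)
      + fderiv ℝ ω x (basisVec j) * (w x * q j x))) (volume.restrict Ω) :=
    integrable_finsetSum _ fun j _ => iB j
  have hsum : ∑ j, bdryForm Ω j ω w (w' j) (q j) (q' j j)
      = ∫ x in Ω, ∑ j, (ω x * (w' j x * q j x + w x * q' j j x)
        + fderiv ℝ ω x (basisVec j) * (w x * q j x)) :=
    (integral_finsetSum _ fun j _ => iB j).symm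
  -- Adding twice the integrand of the boundary term cancels the cross terms and leaves only `2 w
  -- ∇ω·q`. The added integral is nonpositive by `hbdry`, so a pointwise inequality suffices.
  have hle : ∫ x in Ω, (1 - θ) * min c (c ^ 2) * ((w x ^ 2 + ∑ j, w' j x ^ 2) + ∑ j, q j x ^ 2)
      ≤ ∫ x in Ω, (errorDensity ω w w' q q' x
        + 2 * ∑ j, (ω x * (w' j x * q j x + w x * q' j j x)
          + fderiv ℝ ω x (basisVec j) * (w x * q j x))) := by
    refine setIntegral_mono_on ((i1.add i2).const_mul _) (iE.add (iS.const_mul 2))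
      hΩ.measurableSet fun x hx => ?_
    set Q := ∑ j, q j x ^ 2
    set W := ∑ j, w' j x ^ 2
    set s := ∑ j, fderiv ℝ ω x (basisVec j) * q j x
    set t := ∑ j, q' j j x
    have hQ : 0 ≤ Q := Finset.sum_nonneg fun j _ => sq_nonneg _
    have hW : 0 ≤ W := Finset.sum_nonneg fun j _ => sq_nonneg _
    have e1 : ∑ j, (q j x - w' j x) ^ 2 = Q + W - 2 * ∑ j, w' j x * q j x := by
      simp only [Q, W, Finset.mul_sum, ← Finset.sum_add_distrib, ← Finset.sum_sub_distrib]
      exact Finset.sum_congr rfl fun j _ => by ring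
    have e2 : ∑ j, (ω x * (w' j x * q j x + w x * q' j j x)
        + fderiv ℝ ω x (basisVec j) * (w x * q j x))
        = ω x * ((∑ j, w' j x * q j x) + w x * t) + w x * s := by
      simp only [t, s, Finset.mul_sum, ← Finset.sum_add_distrib]
      exact Finset.sum_congr rfl fun j _ => by ring
    have e3 : errorDensity ω w w' q q' x + 2 * ∑ j, (ω x * (w' j x * q j x + w x * q' j j x)
        + fderiv ℝ ω x (basisVec j) * (w x * q j x))
        = ω x * Q + ω x * W + t ^ 2 + (ω x * w x) ^ 2 + 2 * (w x * s) := by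
      rw [e2, errorDensity, e1]
      ring
    have hs : |s| ≤ θ * (c * √c) * √Q := by
      have h1 : s ^ 2 ≤ (∑ j, fderiv ℝ ω x (basisVec j) ^ 2) * Q :=
        Finset.sum_mul_sq_le_sq_mul_sq _ _ _
      rw [sum_fderiv_sq] at h1
      refine abs_le_of_sq_le_sq ?_ (by positivity)
      rw [mul_pow, Real.sq_sqrt hQ]
      refine h1.trans ?_
      gcongr
      exact hgrad x hx
    have hsc : √c * √c = c := Real.mul_self_sqrt hc.le
    have hsQ : √Q * √Q = Q := Real.mul_self_sqrt hQ
    have hws : -(θ * (c ^ 2 * w x ^ 2 + c * Q)) ≤ 2 * (w x * s) := by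
      have h1 : |w x * s| ≤ |w x| * (θ * (c * √c) * √Q) := by
        rw [abs_mul]; gcongr
      -- Young's inequality from the square of `c|w| - √c|q|`; this is where the threshold `c^{3/2}`
      -- for the gradient originates.
      have h2 : 2 * (|w x| * ((c * √c) * √Q)) ≤ c ^ 2 * w x ^ 2 + c * Q := by
        have := sq_nonneg (c * |w x| - √c * √Q)
        have e : (c * |w x| - √c * √Q) ^ 2
            = c ^ 2 * |w x| ^ 2 + (√c * √c) * (√Q * √Q) - 2 * (|w x| * ((c * √c) * √Q)) := by ring
        rw [e, hsc, hsQ, sq_abs] at this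
        linarith
      have h3 := neg_abs_le (w x * s)
      nlinarith [mul_le_mul_of_nonneg_left h2 hθ0]
    have hωc := hcω x hx
    rw [e3]
    have m1 : min c (c ^ 2) ≤ c := min_le_left _ _
    have m2 : min c (c ^ 2) ≤ c ^ 2 := min_le_right _ _
    have m0 : 0 ≤ min c (c ^ 2) := le_min hc.le (sq_nonneg c)
    have b1 : c * Q ≤ ω x * Q := by gcongr
    have b2 : (1 - θ) * (min c (c ^ 2) * W) ≤ ω x * W := by
      have : (1 - θ) * (min c (c ^ 2) * W) ≤ 1 * (ω x * W) := by
        gcongr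
        · linarith
        · exact m1.trans hωc
      linarith
    have b3 : c ^ 2 * w x ^ 2 ≤ (ω x * w x) ^ 2 := by
      rw [mul_pow]; gcongr
    have b4 : (1 - θ) * (min c (c ^ 2) * w x ^ 2) ≤ (1 - θ) * (c ^ 2 * w x ^ 2) := by
      have : 0 ≤ 1 - θ := by linarith
      gcongr
    have b5 : (1 - θ) * (min c (c ^ 2) * Q) ≤ (1 - θ) * (c * Q) := by
      have : 0 ≤ 1 - θ := by linarith
      gcongr
    nlinarith [sq_nonneg t]
  rw [integral_const_mul, integral_add i1 i2, integral_add iE (iS.const_mul 2),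
    integral_const_mul, ← hsum] at hle
  linarith

/-- Boundedness of the least-squares functional. -/
lemma errorDensity_le (hΩ : IsOpen Ω) (hω : C1Bdd Ω ω) {M : ℝ} (hω0 : ∀ x ∈ Ω, 0 ≤ ω x)
    (hM : ∀ x ∈ Ω, ω x ≤ M) (hM0 : 0 ≤ M)
    (hw : ∀ j, WeakPartial Ω j w (w' j)) (hw0 : MemLp w 2 (volume.restrict Ω))
    (hq : ∀ i j, WeakPartial Ω j (q i) (q' i j)) :
    ∫ x in Ω, errorDensity ω w w' q q' x ≤ (2 * M + 2 * M ^ 2 + 2 * d + 1) *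
      ((∫ x in Ω, (w x ^ 2 + ∑ j, w' j x ^ 2))
        + ∑ i, ∫ x in Ω, (q i x ^ 2 + ∑ j, q' i j x ^ 2)) := by
  have i1 : Integrable (fun x => w x ^ 2 + ∑ j, w' j x ^ 2) (volume.restrict Ω) :=
    hw0.integrable_sq.add (integrable_finsetSum _ fun j _ => (hw j).memLp_deriv.integrable_sq)
  have i2 : ∀ i, Integrable (fun x => q i x ^ 2 + ∑ j, q' i j x ^ 2) (volume.restrict Ω) :=
    fun i => (hq i i).memLp.integrable_sq.add
      (integrable_finsetSum _ fun j _ => (hq i j).memLp_deriv.integrable_sq)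
  rw [← integral_finsetSum _ fun i _ => i2 i,
    ← integral_add i1 (integrable_finsetSum _ fun i _ => i2 i), ← integral_const_mul]
  refine setIntegral_mono_on (integrable_errorDensity hΩ hω hw hw0 hq)
    ((i1.add (integrable_finsetSum _ fun i _ => i2 i)).const_mul _) hΩ.measurableSet fun x hx => ?_
  have h0 := hω0 x hx
  have h1 := hM x hx
  rw [Finset.sum_add_distrib]
  set Q := ∑ j, q j x ^ 2
  set W := ∑ j, w' j x ^ 2
  set T := ∑ i, ∑ j, q' i j x ^ 2
  set t := ∑ j, q' j j x
  have hQ : 0 ≤ Q := Finset.sum_nonneg fun j _ => sq_nonneg _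
  have hW : 0 ≤ W := Finset.sum_nonneg fun j _ => sq_nonneg _
  have hT : 0 ≤ T := Finset.sum_nonneg fun i _ => Finset.sum_nonneg fun j _ => sq_nonneg _
  have b1 : ∑ j, (q j x - w' j x) ^ 2 ≤ 2 * (Q + W) := by
    simp only [Q, W, Finset.mul_sum, ← Finset.sum_add_distrib]
    exact Finset.sum_le_sum fun j _ => by nlinarith [sq_nonneg (q j x + w' j x)]
  have b2 : t ^ 2 ≤ d * T := by
    have h2 : t ^ 2 ≤ d * ∑ j, q' j j x ^ 2 := by
      simpa using sq_sum_le_card_mul_sum_sq (s := (Finset.univ : Finset (Fin d)))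
        (f := fun j => q' j j x)
    refine h2.trans (mul_le_mul_of_nonneg_left (Finset.sum_le_sum fun i _ => ?_)
      (Nat.cast_nonneg d))
    exact Finset.single_le_sum (f := fun j => q' i j x ^ 2) (fun j _ => sq_nonneg _)
      (Finset.mem_univ i)
  have b3 : ω x * ∑ j, (q j x - w' j x) ^ 2 ≤ M * (2 * (Q + W)) :=
    mul_le_mul h1 b1 (Finset.sum_nonneg fun j _ => sq_nonneg _) hM0
  have b4 : (-t + ω x * w x) ^ 2 ≤ 2 * (d * T) + 2 * (M ^ 2 * w x ^ 2) := by
    have : (ω x * w x) ^ 2 ≤ M ^ 2 * w x ^ 2 := by rw [mul_pow]; gcongr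
    nlinarith [sq_nonneg (t + ω x * w x)]
  have hd : (0 : ℝ) ≤ d := Nat.cast_nonneg d
  rw [errorDensity]
  -- One constant serves all terms by adding the separate coefficients, so the surplus products must
  -- be nonnegative.
  have p1 := mul_nonneg hM0 hT
  have p2 := mul_nonneg hM0 (sq_nonneg (w x))
  have p3 := mul_nonneg (sq_nonneg M) hQ
  have p4 := mul_nonneg (sq_nonneg M) hW
  have p5 := mul_nonneg (sq_nonneg M) hT
  have p6 := mul_nonneg hd hQ
  have p7 := mul_nonneg hd hW
  have p8 := mul_nonneg hd (sq_nonneg (w x))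
  nlinarith [sq_nonneg (w x)]

end leastSquares

/-! ### The exact solution and the three boundary conditions -/

section exactSolution

variable {Ω : Set (E d)} {ω f g ue : E d → ℝ} {bc : BoundaryCondition}

lemma inner_eq_sum (x y : E d) : inner ℝ x y = ∑ i, x i * y i := by
  simp [PiLp.inner_apply, mul_comm]

/-- The equation holds almost everywhere for a weak solution in `H²`. -/
lemma IsExactSolution.ae_eq (hΩ : IsOpen Ω) (hω : C1Bdd Ω ω) (hf : MemLp f 2 (volume.restrict Ω))
    (h : IsExactSolution Ω ω f g bc ue) :
    ∀ᵐ x ∂volume.restrict Ω,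
      -(∑ j, weakGradient Ω (fun x => weakGradient Ω ue x j) x j) + ω x * ue x - f x = 0 := by
  obtain ⟨⟨h1, h2⟩, hweak, -⟩ := h
  have hu := h1.weakPartial hΩ
  have hG := fun i => (h2 i).weakPartial hΩ
  have hm : MemLp (fun x => ∑ j, weakGradient Ω (fun x => weakGradient Ω ue x j) x j) 2
      (volume.restrict Ω) := memLp_finsetSum _ fun j _ => (hG j j).memLp_deriv
  have hωu := hω.memLp_mul hΩ h1.1
  refine ae_eq_zero_of_forall_test hΩ ((hm.neg.add hωu).sub hf) fun φ hφ => ?_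
  have hw := hweak φ hφ
  have i1 : ∀ j, Integrable (fun x => weakGradient Ω ue x j * fderiv ℝ φ x (basisVec j))
      (volume.restrict Ω) := fun j => integrable_fun_mul (hu j).memLp_deriv (hφ.memLp_fderiv _)
  have i2 := integrable_fun_mul hωu hφ.memLp
  have i3 : ∀ j, Integrable (fun x => weakGradient Ω (fun x => weakGradient Ω ue x j) x j * φ x)
      (volume.restrict Ω) := fun j => integrable_fun_mul (hG j j).memLp_deriv hφ.memLp
  have i3s : Integrable (fun x => -∑ j, weakGradient Ω (fun x => weakGradient Ω ue x j) x j * φ x)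
      (volume.restrict Ω) := (integrable_finsetSum _ fun j _ => i3 j).neg
  have i4 := integrable_fun_mul hf hφ.memLp
  have i5 : Integrable (fun x =>
      -∑ j, weakGradient Ω (fun x => weakGradient Ω ue x j) x j * φ x + ω x * ue x * φ x)
      (volume.restrict Ω) := i3s.add i2
  have e1 : ∫ x in Ω, (inner ℝ (weakGradient Ω ue x) (gradient φ x) + ω x * ue x * φ x)
      = -(∑ j, ∫ x in Ω, weakGradient Ω (fun x => weakGradient Ω ue x j) x j * φ x)
        + ∫ x in Ω, ω x * ue x * φ x := by
    simp only [inner_eq_sum, gradient_apply]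
    rw [integral_add (integrable_finsetSum _ fun j _ => i1 j) i2,
      integral_finsetSum _ fun j _ => i1 j, ← Finset.sum_neg_distrib]
    congr 1
    exact Finset.sum_congr rfl fun j _ => (hG j j).integral_eq φ hφ
  have e2 : ∫ x in Ω, (-(∑ j, weakGradient Ω (fun x => weakGradient Ω ue x j) x j)
        + ω x * ue x - f x) * φ x
      = -(∑ j, ∫ x in Ω, weakGradient Ω (fun x => weakGradient Ω ue x j) x j * φ x)
        + (∫ x in Ω, ω x * ue x * φ x) - ∫ x in Ω, f x * φ x := by
    rw [← integral_finsetSum _ fun j _ => i3 j, ← integral_neg,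
      ← integral_add i3s i2, ← integral_sub i5 i4]
    refine integral_congr_ae (Eventually.of_forall fun x => ?_)
    simp only [← Finset.sum_mul]
    ring
  refine Eq.trans e2 ?_
  rw [← e1, hw, sub_self]

/-- The boundary term has the good sign for every boundary condition. -/
lemma sum_bdryForm_nonpos_of_bc (hΩ : IsOpen Ω) (hb : Bornology.IsBounded Ω)
    (hsm : HasSmoothBoundary Ω) (hω : C1Bdd Ω ω) (hω0 : ∀ x ∈ Ω, 0 ≤ ω x)
    {v : (E d → ℝ) × (E d → E d)} (hv1 : ContDiff ℝ 1 v.1) (hv2 : ContDiff ℝ 1 v.2)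
    (hvbc : PairSatisfiesBC Ω g v bc) (hbc : SatisfiesBC Ω g ue bc) {G : E d → E d}
    (hG : G = weakGradient Ω ue)
    {w' : Fin d → E d → ℝ} {q' : Fin d → Fin d → E d → ℝ}
    (hw : ∀ j, WeakPartial Ω j (fun x => v.1 x - ue x) (w' j))
    (hq : ∀ i j, WeakPartial Ω j (fun x => v.2 x i - G x i) (q' i j)) :
    ∑ j, bdryForm Ω j ω (fun x => v.1 x - ue x) (w' j) (fun x => v.2 x j - G x j) (q' j j) ≤ 0 := by
  subst hG
  have hr := hsm.choose_spec
  have hnu : ∀ x, outwardNormal Ω x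
      = ‖gradient hsm.choose x‖⁻¹ • gradient hsm.choose x := fun x => by
    rw [outwardNormal, dif_pos hsm]
  have hi : ∀ {N : E d → E d}, ContDiff ℝ 1 N → ContDiff ℝ 1 fun x => inner ℝ (v.2 x) (N x) :=
    fun hN => hv2.inner ℝ hN
  cases bc with
  | dirichlet =>
    obtain ⟨W, hW, hWg, hW0⟩ := hbc
    refine le_of_eq (Finset.sum_eq_zero fun j _ => ?_)
    -- Here the argument with zero trace is `w`, so it is swapped into the last slot.
    rw [bdryForm_comm]
    refine bdryForm_eq_zero_of_trace (h := fun x => v.1 x - W x) (k := fun x => ue x - W x)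
      hΩ hb hω (hq j j) hw (hv1.sub hW) (fun x hx => ?_) hW0 fun x => by ring
    rw [hvbc x hx, hWg x hx, sub_self]
  | neumann =>
    obtain ⟨N, hN, hNν, W, hW, hWg, hW0⟩ := hbc
    -- Neumann is the case `α = 0`. The error in the boundary condition splits as `h - k`, with `h`
    -- of class `C¹` and zero on the frontier and `k` in `H¹₀`.
    refine sum_bdryForm_nonpos hΩ hb hr.1 hr.2.1 hr.2.2 hN (fun x hx => by rw [hNν x hx, hnu])
      le_rfl hω hω0 hw hq (h := fun x => inner ℝ (v.2 x) (N x) - W x)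
      ((hi hN).sub hW) (fun x hx => ?_) hW0 fun x => ?_
    · have := hvbc x hx
      rw [hNν x hx, hWg x hx, this, sub_self]
    · simp only [inner_eq_sum, mul_comm (N x _), sub_mul, Finset.sum_sub_distrib]
      ring
  | robin α hα =>
    obtain ⟨N, hN, hNν, W, hW, hWg, hW0⟩ := hbc
    refine sum_bdryForm_nonpos hΩ hb hr.1 hr.2.1 hr.2.2 hN (fun x hx => by rw [hNν x hx, hnu])
      hα.le hω hω0 hw hq (h := fun x => α * v.1 x + inner ℝ (v.2 x) (N x) - W x)
      (((contDiff_const.mul hv1).add (hi hN)).sub hW) (fun x hx => ?_) hW0 fun x => ?_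
    · have := hvbc x hx
      rw [hNν x hx, hWg x hx, this, sub_self]
    · simp only [inner_eq_sum, mul_comm (N x _), sub_mul, Finset.sum_sub_distrib]
      ring

end exactSolution

/-! ### Equivalence of loss and error; error splitting -/

section errors

variable {Ω : Set (E d)} {ω f g ue : E d → ℝ} {bc : BoundaryCondition}

lemma coord_contDiff {p : E d → E d} (hp : ContDiff ℝ 1 p) (i : Fin d) :
    ContDiff ℝ 1 fun x => p x i :=
  (EuclideanSpace.proj (𝕜 := ℝ) i : E d →L[ℝ] ℝ).contDiff.comp hp

lemma divergence_eq_sum {p : E d → E d} (hp : ContDiff ℝ 1 p) (x : E d) :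
    divergence p x = ∑ i, fderiv ℝ (fun x => p x i) x (basisVec i) := by
  refine Finset.sum_congr rfl fun i _ => ?_
  have e := ((EuclideanSpace.proj (𝕜 := ℝ) i : E d →L[ℝ] ℝ).hasFDerivAt.comp x
    (hp.differentiable one_ne_zero x).hasFDerivAt).fderiv
  rw [show fderiv ℝ (fun x => p x i) x = _ from e]
  rfl

/-- The least-squares loss is equivalent to the squared error. -/
lemma loss_equiv (hΩ : IsOpen Ω) (hb : Bornology.IsBounded Ω) (hsm : HasSmoothBoundary Ω)
    (hω : C1Bdd Ω ω) {c θ M : ℝ} (hc : 0 < c) (hθ0 : 0 ≤ θ) (hθ1 : θ < 1)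
    (hcω : ∀ x ∈ Ω, c ≤ ω x) (hgrad : ∀ x ∈ Ω, ‖gradient ω x‖ ≤ θ * (c * √c))
    (hM : ∀ x ∈ Ω, ω x ≤ M) (hM0 : 0 ≤ M) (hf : MemLp f 2 (volume.restrict Ω))
    (hue : IsExactSolution Ω ω f g bc ue)
    {v : (E d → ℝ) × (E d → E d)} (hv1 : ContDiff ℝ 1 v.1) (hv2 : ContDiff ℝ 1 v.2)
    (hvbc : PairSatisfiesBC Ω g v bc) :
    (1 - θ) * min c (c ^ 2) * (h1NormSq Ω (fun x => v.1 x - ue x)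
        + ∫ x in Ω, ‖v.2 x - weakGradient Ω ue x‖ ^ 2) ≤ loss Ω ω f v ∧
      loss Ω ω f v ≤ (2 * M + 2 * M ^ 2 + 2 * d + 1) * (h1NormSq Ω (fun x => v.1 x - ue x)
        + h1NormSqVec Ω (fun x => v.2 x - weakGradient Ω ue x)) := by
  have hae := hue.ae_eq hΩ hω hf
  obtain ⟨⟨h1, h2⟩, -, hbc⟩ := hue
  set G := weakGradient Ω ue
  have hω0 : ∀ x ∈ Ω, 0 ≤ ω x := fun x hx => hc.le.trans (hcω x hx)
  have hw : ∀ j, WeakPartial Ω j (fun x => v.1 x - ue x)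
      fun x => fderiv ℝ v.1 x (basisVec j) - G x j := fun j =>
    (WeakPartial.of_contDiff hb hv1).sub (h1.weakPartial hΩ j)
  have hq : ∀ i j, WeakPartial Ω j (fun x => v.2 x i - G x i)
      fun x => fderiv ℝ (fun x => v.2 x i) x (basisVec j)
        - weakGradient Ω (fun x => G x i) x j := fun i j =>
    (WeakPartial.of_contDiff hb (coord_contDiff hv2 i)).sub ((h2 i).weakPartial hΩ j)
  have hw0 : MemLp (fun x => v.1 x - ue x) 2 (volume.restrict Ω) := by
    -- For `d = 0` no weak partial derivative is available to provide integrability.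
    rcases isEmpty_or_nonempty (Fin d) with he | ⟨⟨j⟩⟩
    · exact (((C1Bdd.of_contDiff hb hv1).memLp_mul hΩ (v := fun _ => 1) (by
        have : IsFiniteMeasure (volume.restrict Ω : Measure (E d)) :=
          ⟨by simp [hb.measure_lt_top]⟩
        exact memLp_const 1)).sub h1.1).ae_eq (Eventually.of_forall fun x => by simp)
    · exact (hw j).memLp
  have hbd := sum_bdryForm_nonpos_of_bc hΩ hb hsm hω hω0 hv1 hv2 hvbc hbc rfl hw hq
  -- The equation holds almost everywhere for `u_e`, so subtracting its zero residual eliminates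
  -- `f`.
  have hloss : loss Ω ω f v = ∫ x in Ω, errorDensity ω (fun x => v.1 x - ue x)
      (fun j x => fderiv ℝ v.1 x (basisVec j) - G x j) (fun i x => v.2 x i - G x i)
      (fun i j x => fderiv ℝ (fun x => v.2 x i) x (basisVec j)
        - weakGradient Ω (fun x => G x i) x j) x := by
    refine integral_congr_ae ?_
    filter_upwards [hae] with x hx
    rw [lossDensity, errorDensity, EuclideanSpace.norm_sq_eq, divergence_eq_sum hv2]
    simp only [Finset.sum_sub_distrib, PiLp.sub_apply, gradient_apply, Real.norm_eq_abs, sq_abs]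
    congr 1
    · congr 1
      exact Finset.sum_congr rfl fun j _ => by ring
    · congr 1
      linarith
  have hH : h1NormSq Ω (fun x => v.1 x - ue x) = _ := h1NormSq_eq hΩ hw hw0
  have hL : ∫ x in Ω, ‖v.2 x - G x‖ ^ 2 = ∫ x in Ω, ∑ j, (v.2 x j - G x j) ^ 2 := by
    simp [EuclideanSpace.norm_sq_eq]
  have hV : h1NormSqVec Ω (fun x => v.2 x - G x) = _ := Finset.sum_congr rfl fun i _ =>
    h1NormSq_eq hΩ (fun j => hq i j) (hq i i).memLp
  rw [hloss, hH, hL, hV]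
  exact ⟨coercive_errorDensity hΩ hω hc hθ0 hθ1 hcω hgrad hw hw0 hq hbd,
    errorDensity_le hΩ hω hω0 hM hM0 hw hw0 hq⟩

/-- The term `f x ^ 2` is kept pointwise: its integral is finite for `f` in `L²`, and at sample
points it is a fixed number, whereas an essential bound on `f` says nothing at given points. -/
lemma lossDensity_le {v : (E d → ℝ) × (E d → E d)} {K M : ℝ} {x : E d} (h0 : 0 ≤ ω x)
    (hM : ω x ≤ M) (h1 : |v.1 x| ≤ K) (h2 : ‖v.2 x‖ ≤ K) (h3 : ‖gradient v.1 x‖ ≤ K)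
    (h4 : |divergence v.2 x| ≤ K) :
    lossDensity ω f v x ≤ M * (K + K) ^ 2 + 2 * (K + M * K) ^ 2 + 2 * f x ^ 2 := by
  have hK : 0 ≤ K := (abs_nonneg _).trans h1
  have a1 : ω x * ‖v.2 x - gradient v.1 x‖ ^ 2 ≤ M * (K + K) ^ 2 := by
    have : ‖v.2 x - gradient v.1 x‖ ≤ K + K := (norm_sub_le _ _).trans (add_le_add h2 h3)
    gcongr
    exact h0.trans hM
  have a2 : |-divergence v.2 x + ω x * v.1 x| ≤ K + M * K := by
    refine (abs_add_le _ _).trans ?_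
    rw [abs_neg, abs_mul, abs_of_nonneg h0]
    gcongr
    exact h0.trans hM
  have a3 : (-divergence v.2 x + ω x * v.1 x) ^ 2 ≤ (K + M * K) ^ 2 := by
    rw [← sq_abs]; gcongr
  rw [lossDensity]
  nlinarith [sq_nonneg (-divergence v.2 x + ω x * v.1 x + f x)]

lemma lossDensity_nonneg {v : (E d → ℝ) × (E d → E d)} {x : E d} (h0 : 0 ≤ ω x) :
    0 ≤ lossDensity ω f v x := by
  rw [lossDensity]; positivity

/-- Splitting of the loss of the computed solution into approximation, statistical and
optimization errors. -/
lemma le_of_error_splitting {V : Type*} {P : Set V} {L LN A : V → ℝ} {C : ℝ} (hC : 1 ≤ C)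
    (hLA : ∀ v ∈ P, L v ≤ C * A v) (hb1 : BddAbove (Set.range fun v : P => L v - LN v))
    (hb2 : BddAbove (Set.range fun v : P => LN v - L v)) {vA vhat : V} (hvA : vA ∈ P)
    (hmin : IsMinOn LN P vhat) :
    L vA ≤ C * ((⨅ v : P, A v) + ((⨆ v : P, (L v - LN v)) + ⨆ v : P, (LN v - L v))
      + (LN vA - LN vhat)) := by
  have : Nonempty P := ⟨⟨vA, hvA⟩⟩
  set S1 := ⨆ v : P, (L v - LN v)
  set S2 := ⨆ v : P, (LN v - L v)
  have s1 : ∀ v ∈ P, L v - LN v ≤ S1 := fun v hv => le_ciSup hb1 ⟨v, hv⟩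
  have s2 : ∀ v ∈ P, LN v - L v ≤ S2 := fun v hv => le_ciSup hb2 ⟨v, hv⟩
  have hopt : LN vhat ≤ LN vA := hmin hvA
  have hC0 : 0 < C := one_pos.trans_le hC
  -- For every competitor, `L vA ≤ S1 + LN vA`, then `LN vhat ≤ LN v ≤ L v + S2` and `L v ≤ C A v`;
  -- the infimum is taken last.
  have hkey : (L vA - S1 - S2 - (LN vA - LN vhat)) / C ≤ ⨅ v : P, A v := by
    refine le_ciInf fun v => ?_
    rw [div_le_iff₀ hC0]
    have e1 := hLA v v.2
    have e2 := s2 v v.2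
    have e3 := s1 vA hvA
    have e4 : LN vhat ≤ LN v := hmin v.2
    linarith
  rw [div_le_iff₀ hC0] at hkey
  -- Both suprema evaluated at `vA` show `S1 + S2 ≥ 0`, and the optimization error is nonnegative,
  -- so `C ≥ 1` may multiply them.
  have e5 := s1 vA hvA
  have e6 := s2 vA hvA
  nlinarith

end errors

end MIM

/-! ### Choice of constants and conclusion -/

theorem mainTheorem3 (d : ℕ) (hd : 1 ≤ d)
    -- the domain
    (Ω : Set (MIM.E d)) (hΩ_open : IsOpen Ω) (hΩ_convex : Convex ℝ Ω)
    (hΩ_bdd : Bornology.IsBounded Ω) (hΩ_smooth : MIM.HasSmoothBoundary Ω)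
    -- the coefficients of the problem
    (ω f g : MIM.E d → ℝ) (bc : MIM.BoundaryCondition)
    (hf_bdd : MemLp f ⊤ (volume.restrict Ω)) (hf : MIM.MemH1 Ω f)
    (hg : ∃ G : MIM.E d → ℝ, ContDiff ℝ 2 G ∧ ∀ x ∈ frontier Ω, G x = g x)
    (hω : ContDiffOn ℝ 2 ω Ω)
    (cω : ℝ) (hcω : 0 < cω) (hω_lower : ∀ x ∈ Ω, cω ≤ ω x)
    (hω_grad : eLpNorm (fun x => gradient ω x) ⊤ (volume.restrict Ω)
      < ENNReal.ofReal (cω ^ (3 / 2 : ℝ))) :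
    ∃ C : ℝ, 0 < C ∧
      -- the exact solution `(u_e, p_e)` with `p_e = ∇u_e`
      ∀ ue : MIM.E d → ℝ, MIM.IsExactSolution Ω ω f g bc ue →
      -- the parametrized class `P`
      ∀ ρ : ℝ → ℝ, (ρ = Real.sigmoid ∨ ρ = Real.tanh) →
      ∀ D : ℕ, 1 ≤ D → ∀ (n : ℕ) (B : ℝ)
        (φ : MIM.E d × (Fin (d + 1) → ℝ) → (Fin (d + 1) → ℝ)), ContDiff ℝ 1 φ →
      (∀ v ∈ MIM.modifiedClass ρ D n B φ, MIM.PairSatisfiesBC Ω g v bc) →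
      -- the sample points, the empirical minimizer and the output of the algorithm
      ∀ (N : ℕ), 1 ≤ N → ∀ X : Fin N → MIM.E d, (∀ k, X k ∈ Ω) →
      ∀ vhat ∈ MIM.modifiedClass ρ D n B φ,
      IsMinOn (MIM.empiricalLoss Ω ω f X) (MIM.modifiedClass ρ D n B φ) vhat →
      ∀ vA ∈ MIM.modifiedClass ρ D n B φ,
        MIM.h1Norm Ω (fun x => vA.1 x - ue x)
            + MIM.l2NormVec Ω (fun x => vA.2 x - MIM.weakGradient Ω ue x)
          ≤ C * Real.sqrt (MIM.approximationError Ω (MIM.modifiedClass ρ D n B φ) ue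
            + MIM.statisticalError Ω ω f X (MIM.modifiedClass ρ D n B φ)
            + MIM.optimizationError Ω ω f X vA vhat) := by
  set T := (eLpNorm (fun x => gradient ω x) ⊤ (volume.restrict Ω)).toReal
  have hpow : cω ^ (3 / 2 : ℝ) = cω * √cω := by
    rw [Real.sqrt_eq_rpow, ← Real.rpow_one_add' hcω.le (by norm_num)]
    norm_num
  have hcc : 0 < cω * √cω := mul_pos hcω (Real.sqrt_pos.2 hcω)
  have hTc : T < cω * √cω := by
    rw [← hpow]
    exact ENNReal.toReal_lt_of_lt_ofReal hω_grad
  have hgT := MIM.norm_gradient_le_of_eLpNorm hΩ_open hω (ne_top_of_lt hω_grad)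
  -- The strict inequality for the gradient becomes the gap `1 - θ > 0` in the coercivity constant.
  set θ := T / (cω * √cω)
  have hθ0 : 0 ≤ θ := div_nonneg ENNReal.toReal_nonneg hcc.le
  have hθ1 : θ < 1 := (div_lt_one hcc).2 hTc
  have hgrad : ∀ x ∈ Ω, ‖gradient ω x‖ ≤ θ * (cω * √cω) := fun x hx => by
    rw [div_mul_cancel₀ _ hcc.ne']
    exact hgT x hx
  have hωb : MIM.C1Bdd Ω ω := MIM.C1Bdd.of_norm_gradient_le hΩ_open hΩ_convex hΩ_bdd
    (hω.of_le (by norm_num)) hgT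
  obtain ⟨M₀, hM₀⟩ := hωb.bdd
  set M := max M₀ 0
  have hM : ∀ x ∈ Ω, ω x ≤ M := fun x hx =>
    ((le_abs_self _).trans (hM₀ x hx).1).trans (le_max_left _ _)
  have hM0 : 0 ≤ M := le_max_right _ _
  have hω0 : ∀ x ∈ Ω, 0 ≤ ω x := fun x hx => hcω.le.trans (hω_lower x hx)
  set c₁ := (1 - θ) * min cω (cω ^ 2)
  have hc₁ : 0 < c₁ := mul_pos (by linarith) (lt_min hcω (by positivity))
  set c₂ := 2 * M + 2 * M ^ 2 + 2 * d + 1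
  have hc₂ : 1 ≤ c₂ := by
    have : 0 ≤ 2 * M + 2 * M ^ 2 + 2 * (d : ℝ) := by positivity
    linarith
  have hc₂0 : 0 < c₂ := one_pos.trans_le hc₂
  -- The factor `2` accounts for the two norms, each bounded separately. Both constants come from
  -- `ω` and `d` alone.
  refine ⟨2 * √(c₂ / c₁), by positivity, ?_⟩
  intro ue hue ρ hρ D hD n B φ hφ hbc N hN X hX vhat hvhat hmin vA hvA
  have hρ' : MIM.TameActivation ρ := by
    rcases hρ with rfl | rfl
    exacts [MIM.tameActivation_sigmoid, MIM.tameActivation_tanh]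
  set P := MIM.modifiedClass ρ D n B φ
  -- The bound `K` depends on the network class; it only makes the suprema finite and does not enter
  -- the final constant.
  obtain ⟨K, hK⟩ := MIM.exists_bound_modifiedClass hΩ_bdd hρ' hD n B hφ
  have hf2 : MemLp f 2 (volume.restrict Ω) := hf.1
  have heq := fun v (hv : v ∈ P) => MIM.loss_equiv hΩ_open hΩ_bdd hΩ_smooth hωb hcω hθ0 hθ1
    hω_lower hgrad hM hM0 hf2 hue (hK v hv).1 (hK v hv).2.1 (hbc v hv)
  have hden : ∀ v ∈ P, ∀ x ∈ Ω, MIM.lossDensity ω f v x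
      ≤ M * (K + K) ^ 2 + 2 * (K + M * K) ^ 2 + 2 * f x ^ 2 := fun v hv x hx =>
    have h := (hK v hv).2.2 x hx
    MIM.lossDensity_le (hω0 x hx) (hM x hx) h.1 h.2.1 h.2.2.1 h.2.2.2
  have hL0 : ∀ v, 0 ≤ MIM.loss Ω ω f v := fun v =>
    setIntegral_nonneg hΩ_open.measurableSet fun x hx => MIM.lossDensity_nonneg (hω0 x hx)
  have hE0 : ∀ v, 0 ≤ MIM.empiricalLoss Ω ω f X v := fun v =>
    mul_nonneg (by positivity)
      (Finset.sum_nonneg fun k _ => MIM.lossDensity_nonneg (hω0 _ (hX k)))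
  have hfin : IsFiniteMeasure (volume.restrict Ω : Measure (MIM.E d)) :=
    ⟨by simpa using hΩ_bdd.measure_lt_top⟩
  -- A real supremum over an unbounded family has the default value `0` and would bound nothing, so
  -- boundedness has to be proved.
  have hb1 : BddAbove (Set.range fun v : P =>
      MIM.loss Ω ω f v.1 - MIM.empiricalLoss Ω ω f X v.1) := by
    refine ⟨∫ x in Ω, (M * (K + K) ^ 2 + 2 * (K + M * K) ^ 2 + 2 * f x ^ 2), ?_⟩
    rintro _ ⟨v, rfl⟩
    have h : MIM.loss Ω ω f v.1
        ≤ ∫ x in Ω, (M * (K + K) ^ 2 + 2 * (K + M * K) ^ 2 + 2 * f x ^ 2) := by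
      refine integral_mono_of_nonneg ?_ ((integrable_const _).add (hf2.integrable_sq.const_mul 2)) ?_
      · filter_upwards [ae_restrict_mem hΩ_open.measurableSet] with x hx
          using MIM.lossDensity_nonneg (hω0 x hx)
      · filter_upwards [ae_restrict_mem hΩ_open.measurableSet] with x hx using hden v.1 v.2 x hx
    have := hE0 v.1
    simp only
    linarith
  have hb2 : BddAbove (Set.range fun v : P =>
      MIM.empiricalLoss Ω ω f X v.1 - MIM.loss Ω ω f v.1) := by
    refine ⟨volume.real Ω / N * ∑ k, (M * (K + K) ^ 2 + 2 * (K + M * K) ^ 2 + 2 * f (X k) ^ 2), ?_⟩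
    rintro _ ⟨v, rfl⟩
    have h : MIM.empiricalLoss Ω ω f X v.1 ≤ volume.real Ω / N *
        ∑ k, (M * (K + K) ^ 2 + 2 * (K + M * K) ^ 2 + 2 * f (X k) ^ 2) :=
      mul_le_mul_of_nonneg_left (Finset.sum_le_sum fun k _ => hden v.1 v.2 _ (hX k))
        (by positivity)
    have := hL0 v.1
    simp only
    linarith
  have hsplit := MIM.le_of_error_splitting (L := MIM.loss Ω ω f) hc₂ (fun v hv => (heq v hv).2)
    hb1 hb2 hvA hmin
  have hlow := (heq vA hvA).1
  have hEq : (⨅ v : P, (MIM.h1NormSq Ω (fun x => v.1.1 x - ue x)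
      + MIM.h1NormSqVec Ω (fun x => v.1.2 x - MIM.weakGradient Ω ue x)))
      + ((⨆ v : P, (MIM.loss Ω ω f v.1 - MIM.empiricalLoss Ω ω f X v.1))
        + ⨆ v : P, (MIM.empiricalLoss Ω ω f X v.1 - MIM.loss Ω ω f v.1))
      + (MIM.empiricalLoss Ω ω f X vA - MIM.empiricalLoss Ω ω f X vhat)
      = MIM.approximationError Ω P ue + MIM.statisticalError Ω ω f X P
        + MIM.optimizationError Ω ω f X vA vhat := rfl
  rw [hEq] at hsplit
  set 𝓔 := MIM.approximationError Ω P ue + MIM.statisticalError Ω ω f X P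
        + MIM.optimizationError Ω ω f X vA vhat
  set a := MIM.h1NormSq Ω (fun x => vA.1 x - ue x)
  set b := ∫ x in Ω, ‖vA.2 x - MIM.weakGradient Ω ue x‖ ^ 2
  have ha0 : 0 ≤ a := integral_nonneg fun x => by positivity
  have hb0 : 0 ≤ b := integral_nonneg fun x => by positivity
  have hab : a + b ≤ c₂ / c₁ * 𝓔 := by
    rw [div_mul_eq_mul_div, le_div_iff₀ hc₁]
    linarith
  have h1 : √a ≤ √(c₂ / c₁) * √𝓔 := by
    rw [← Real.sqrt_mul (by positivity)]
    exact Real.sqrt_le_sqrt (by linarith)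
  have h2 : √b ≤ √(c₂ / c₁) * √𝓔 := by
    rw [← Real.sqrt_mul (by positivity)]
    exact Real.sqrt_le_sqrt (by linarith)
  change √a + √b ≤ 2 * √(c₂ / c₁) * √𝓔
  linarith
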